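/- Let $G\subset\mathbb C$ be a domain (a nonempty connected open set) with $0\in G$. A function $w:G\to[-\infty,\infty)$ is called subharmonic on $G$ if it is upper semicontinuous, not identically $-\infty$, and satisfies $w(z)\le\frac1{2\pi}\int_0^{2\pi}w(z+re^{i\theta})\,d\theta$ whenever $r>0$ and the closed disc of centre $z$ and radius $r$ is contained in $G$; let $\mathcal{SH}(G)$ be the class of these functions. Let $M:G\to\mathbb R$ be continuous, let $u\in\mathcal{SH}(G)$, and let $H\subset\mathcal{SH}(G)$ be a convex cone (closed under sums and under multiplication by positive reals) that contains the constant functions $0$ and $-1$. Assume that (a) $H$ is sequentially closed in $L^1_{\mathrm{loc}}(G)$: if $h_n\in H$, $w\in L^1_{\mathrm{loc}}(G)$ and $\int_K|h_n-w|\,dm\to0$ for every compact $K\subset G$, where $m$ is Lebesgue measure, then $w$ coincides almost everywhere with an element of $H$; (b) for every $h\in H$ there is a decreasing sequence of continuous real-valued functions $h_n\in H$ with $h_n(z)\to h(z)$ for all $z\in G$. A positive Radon measure $\mu$ with compact support in $G$ is called a Jensen measure with respect to $H$ if $h(0)\le\int h\,d\mu$ for every $h\in H$; let $\mathcal M_H$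 be the set of these measures. (Integrals of functions in $\mathcal{SH}(G)$ take values in $[-\infty,\infty)$.) Then the following statements are equivalent: 1) there is $v\in H$ such that $v(0)\ne-\infty$ and $u(z)+v(z)\le M(z)$ for all $z\in G$; 2) there is a constant $C\in\mathbb R$ such that $\int u\,d\mu\le\int M\,d\mu+C$ for all $\mu\in\mathcal M_H$. -/

import Mathlib

open MeasureTheory Filter Topology

noncomputable section

namespace JensenDuality

/-- The integral of an extended real function, `∫ f⁺ dμ - ∫ f⁻ dμ` in `[-∞, ∞]`.
It is only applied to measurable `f` for which `∫ f⁺ dμ < ∞` (upper semicontinuous functions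
with values in `[-∞, ∞)` and finite measures carried by a compact set). -/
def eintegral {α : Type*} [MeasurableSpace α] (μ : Measure α) (f : α → EReal) : EReal :=
  ((∫⁻ x, (f x).toENNReal ∂μ : ENNReal) : EReal) - ((∫⁻ x, (-f x).toENNReal ∂μ : ENNReal) : EReal)

/-- The normalized Lebesgue measure `dθ / 2π` on `(0, 2π]`. -/
def angleMeasure : Measure ℝ :=
  ENNReal.ofReal (2 * Real.pi)⁻¹ • volume.restrict (Set.Ioc 0 (2 * Real.pi))

/-- `u : G → [-∞, ∞)` is subharmonic on `G`: upper semicontinuous, not identically `-∞`, and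
bounded at `z` by its mean over every circle about `z` that bounds a closed disc inside `G`. -/
structure IsSubharmonic {G : Set ℂ} (u : G → EReal) : Prop where
  ne_top : ∀ z, u z ≠ ⊤
  exists_ne_bot : ∃ z, u z ≠ ⊥
  upperSemicontinuous : UpperSemicontinuous u
  le_circleMean : ∀ (z : G) (r : ℝ) (hr : 0 < r) (hd : Metric.closedBall (z : ℂ) r ⊆ G),
    u z ≤ eintegral angleMeasure
      (fun θ ↦ u ⟨circleMap z r θ, hd (circleMap_mem_closedBall (z : ℂ) hr.le θ)⟩)

/-- `H` is a convex cone in the class of subharmonic functions on `G`. -/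
structure IsConeOfSubharmonic {G : Set ℂ} (H : Set (G → EReal)) : Prop where
  isSubharmonic : ∀ h ∈ H, IsSubharmonic h
  add_mem : ∀ h₁ ∈ H, ∀ h₂ ∈ H, (fun z ↦ h₁ z + h₂ z) ∈ H
  smul_mem : ∀ h ∈ H, ∀ t : ℝ, 0 < t → (fun z ↦ (t : EReal) * h z) ∈ H

/-- Planar Lebesgue measure on `G`. -/
def areaMeasure (G : Set ℂ) : Measure G := (volume : Measure ℂ).comap Subtype.val

/-- Convergence `fₙ → w` in `L¹_loc(G)`: convergence in mean, for planar Lebesgue measure, on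
every compact subset of `G`. The `fₙ` are meant to be finite almost everywhere, so that
`EReal.toReal` changes them on a null set only. -/
def TendstoL1Loc {G : Set ℂ} (f : ℕ → G → EReal) (w : G → ℝ) : Prop :=
  ∀ K : Set G, IsCompact K →
    Tendsto (fun n ↦ ∫⁻ z in K, ENNReal.ofReal |(f n z).toReal - w z| ∂areaMeasure G) atTop (𝓝 0)

/-- `H` is sequentially closed in `L¹_loc(G)`: whenever a sequence in `H` converges in `L¹_loc(G)`,
its limit is (the almost everywhere class of) an element of `H`. -/
def IsSeqClosedL1Loc {G : Set ℂ} (H : Set (G → EReal)) : Prop :=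
  ∀ (f : ℕ → G → EReal) (w : G → ℝ), (∀ n, f n ∈ H) → LocallyIntegrable w (areaMeasure G) →
    TendstoL1Loc f w → ∃ h ∈ H, ∀ᵐ z ∂areaMeasure G, h z = (w z : EReal)

/-- Every element of `H` is the pointwise limit of a decreasing sequence of continuous
(real-valued) elements of `H`. -/
def HasContinuousApprox {G : Set ℂ} (H : Set (G → EReal)) : Prop :=
  ∀ h ∈ H, ∃ g : ℕ → G → ℝ,
    (∀ n, Continuous (g n)) ∧ (∀ n, (fun z ↦ (g n z : EReal)) ∈ H) ∧
    (∀ z, Antitone (fun n ↦ g n z)) ∧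
    ∀ z, Tendsto (fun n ↦ (g n z : EReal)) atTop (𝓝 (h z))

/-- `μ` is a Jensen measure for the point `o` with respect to `H`: a positive Radon measure with
compact support in `G` and `h(o) ≤ ∫ h dμ` for all `h ∈ H`. For open `G ⊆ ℂ` a Borel measure on `G`
is Radon as soon as it is finite on compact sets. -/
structure IsJensenMeasure {G : Set ℂ} (o : G) (H : Set (G → EReal)) (μ : Measure G) : Prop where
  finite_on_compacts : IsFiniteMeasureOnCompacts μ
  compact_support : ∃ K : Set G, IsCompact K ∧ μ Kᶜ = 0
  le_integral : ∀ h ∈ H, h o ≤ eintegral μ h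

end JensenDuality

end

noncomputable section

namespace JensenDuality

theorem toENNReal_sub_add_eq {b : ℝ} {x : EReal} (h : x ≤ b) :
    ((b : EReal) - x).toENNReal + x.toENNReal + ENNReal.ofReal (-b)
      = ENNReal.ofReal b + (-x).toENNReal := by
  induction x with
  | bot => simp
  | top => simp at h
  | coe x =>
    have hx : x ≤ b := by exact_mod_cast h
    rw [← EReal.coe_sub, ← EReal.coe_neg]
    simp only [EReal.real_coe_toENNReal]
    rw [← ENNReal.toReal_eq_toReal_iff' (by simp) (by simp)]
    simp only [ENNReal.toReal_add, ENNReal.ofReal_ne_top, ENNReal.add_ne_top, ne_eq,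
      not_false_eq_true, and_self, ENNReal.toReal_ofReal']
    rcases le_total x 0 with h1 | h1 <;> rcases le_total b 0 with h2 | h2 <;>
      simp [h1, h2, hx] <;> linarith

section Integral

variable {α : Type*} [MeasurableSpace α] {μ : Measure α}

theorem measurable_toENNReal_const_sub {f : α → EReal} (hf : Measurable f) (b : ℝ) :
    Measurable fun x ↦ ((b : EReal) - f x).toENNReal := by
  have h : Measurable fun x ↦ (b : EReal) - f x := measurable_const.sub hf
  exact h.ereal_toENNReal

theorem lintegral_toENNReal_add_eq [IsFiniteMeasure μ] {f : α → EReal} (hf : Measurable f) {b : ℝ}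
    (hb : ∀ᵐ x ∂μ, f x ≤ b) :
    ∫⁻ x, ((b : EReal) - f x).toENNReal ∂μ + ∫⁻ x, (f x).toENNReal ∂μ
        + ENNReal.ofReal (-b) * μ Set.univ
      = ENNReal.ofReal b * μ Set.univ + ∫⁻ x, (-f x).toENNReal ∂μ := by
  have hf' : Measurable fun x ↦ (f x).toENNReal := hf.ereal_toENNReal
  rw [← lintegral_const, ← lintegral_add_right _ hf', ← lintegral_add_right _ measurable_const,
    ← lintegral_const, ← lintegral_add_left measurable_const]
  refine lintegral_congr_ae ?_
  filter_upwards [hb] with x hx using toENNReal_sub_add_eq hx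

theorem eintegral_eq_sub [IsFiniteMeasure μ] {f : α → EReal} (hf : Measurable f) {b : ℝ}
    (hb : ∀ᵐ x ∂μ, f x ≤ b) :
    eintegral μ f = ((b * μ.real Set.univ : ℝ) : EReal)
      - ((∫⁻ x, ((b : EReal) - f x).toENNReal ∂μ : ENNReal) : EReal) := by
  have h := lintegral_toENNReal_add_eq hf hb
  have hfin : ∫⁻ x, (f x).toENNReal ∂μ ≠ ⊤ := by
    refine ne_top_of_le_ne_top (b := ∫⁻ _, ENNReal.ofReal b ∂μ) ?_ (lintegral_mono_ae ?_)
    · simp [ENNReal.mul_eq_top]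
    · filter_upwards [hb] with x hx
      simpa using EReal.toENNReal_le_toENNReal hx
  unfold eintegral
  generalize ∫⁻ x, (f x).toENNReal ∂μ = P at *
  generalize ∫⁻ x, (-f x).toENNReal ∂μ = N at *
  generalize ∫⁻ x, ((b : EReal) - f x).toENNReal ∂μ = I at *
  have hm : μ Set.univ = ENNReal.ofReal (μ.real Set.univ) := by simp [Measure.real]
  have hm0 : 0 ≤ μ.real Set.univ := measureReal_nonneg
  generalize μ.real Set.univ = m at *
  rw [hm] at h
  lift P to NNReal using hfin
  by_cases hN : N = ⊤
  · have : I = ⊤ := by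
      by_contra hI
      lift I to NNReal using hI
      rw [hN, add_top] at h
      exact (by finiteness : (I : ENNReal) + P + ENNReal.ofReal (-b) * ENNReal.ofReal m ≠ ⊤) h
    simp [hN, this]
  · have hI : I ≠ ⊤ := by
      rintro rfl
      simp only [top_add] at h
      exact (by finiteness : ENNReal.ofReal b * ENNReal.ofReal m + N ≠ ⊤) h.symm
    lift N to NNReal using hN
    lift I to NNReal using hI
    have h2 := congrArg ENNReal.toReal h
    rw [ENNReal.toReal_add (by finiteness) (by finiteness),
      ENNReal.toReal_add (by finiteness) (by finiteness),
      ENNReal.toReal_add (by finiteness) (by finiteness)] at h2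
    simp only [ENNReal.toReal_mul, ENNReal.toReal_ofReal', ENNReal.coe_toReal] at h2
    rw [max_eq_left hm0] at h2
    have h3 : max b 0 - max (-b) 0 = b := by
      rcases le_total b 0 with h | h <;> simp [h]
    have h4 : (P : ℝ) - N = b * m - I := by linear_combination h2 + m * h3
    change (((P : ℝ) : EReal) - ((N : ℝ) : EReal)) = ((b * m : ℝ) : EReal) - ((I : ℝ) : EReal)
    exact_mod_cast h4

theorem lintegral_le_of_le_eintegral [IsFiniteMeasure μ] {f : α → EReal} (hf : Measurable f)
    {b c : ℝ} (hb : ∀ᵐ x ∂μ, f x ≤ b) (hc : (c : EReal) ≤ eintegral μ f) :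
    ∫⁻ x, ((b : EReal) - f x).toENNReal ∂μ ≤ ENNReal.ofReal (b * μ.real Set.univ - c) := by
  rw [eintegral_eq_sub hf hb] at hc
  generalize ∫⁻ x, ((b : EReal) - f x).toENNReal ∂μ = I at *
  induction I with
  | top =>
    simp at hc
  | coe I =>
    change (c : EReal) ≤ _ - ((I : ℝ) : EReal) at hc
    have : c ≤ b * μ.real Set.univ - I := by exact_mod_cast hc
    rw [← ENNReal.ofReal_coe_nnreal]
    exact ENNReal.ofReal_le_ofReal (by linarith)

theorem le_eintegral_of_lintegral_le [IsFiniteMeasure μ] {f : α → EReal} (hf : Measurable f)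
    {b c : ℝ} (hb : ∀ᵐ x ∂μ, f x ≤ b) (hcb : c ≤ b * μ.real Set.univ)
    (hc : ∫⁻ x, ((b : EReal) - f x).toENNReal ∂μ ≤ ENNReal.ofReal (b * μ.real Set.univ - c)) :
    (c : EReal) ≤ eintegral μ f := by
  rw [eintegral_eq_sub hf hb]
  generalize ∫⁻ x, ((b : EReal) - f x).toENNReal ∂μ = I at *
  lift I to NNReal using ne_top_of_le_ne_top (by simp) hc
  change (c : EReal) ≤ _ - ((I : ℝ) : EReal)
  have : (I : ℝ) ≤ b * μ.real Set.univ - c := by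
    have := ENNReal.toReal_mono (by simp) hc
    rwa [ENNReal.toReal_ofReal (by linarith)] at this
  have : c ≤ b * μ.real Set.univ - I := by linarith
  exact_mod_cast this

/-- Monotone convergence for a decreasing sequence of integrable functions. -/
theorem le_eintegral_of_antitone_tendsto [IsFiniteMeasure μ] {g : ℕ → α → ℝ} {f : α → EReal}
    (hgi : ∀ n, Integrable (g n) μ) (hgm : ∀ n, Measurable (g n)) {b : ℝ} (hb : ∀ x, g 0 x ≤ b)
    (hanti : ∀ x, Antitone fun n ↦ g n x)
    (hlim : ∀ x, Tendsto (fun n ↦ (g n x : EReal)) atTop (𝓝 (f x))) {c : ℝ}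
    (hc : ∀ n, c ≤ ∫ x, g n x ∂μ) : (c : EReal) ≤ eintegral μ f := by
  have hfm : Measurable f :=
    measurable_of_tendsto_metrizable (fun n ↦ (hgm n).coe_real_ereal) (tendsto_pi_nhds.2 hlim)
  have hgb : ∀ n x, g n x ≤ b := fun n x ↦ (hanti x (Nat.zero_le n)).trans (hb x)
  have hfb : ∀ x, f x ≤ b := fun x ↦
    le_of_tendsto (hlim x) (Eventually.of_forall fun n ↦ by exact_mod_cast hgb n x)
  have hint : ∀ n, ∫ x, (b - g n x) ∂μ = b * μ.real Set.univ - ∫ x, g n x ∂μ := fun n ↦ by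
    rw [integral_sub (integrable_const _) (hgi n)]
    simp [mul_comm]
  have hcb : c ≤ b * μ.real Set.univ := by
    have h0 : 0 ≤ ∫ x, (b - g 0 x) ∂μ := integral_nonneg fun x ↦ by simpa using hb x
    linarith [hc 0, hint 0]
  refine le_eintegral_of_lintegral_le hfm (Eventually.of_forall hfb) hcb ?_
  have hT := lintegral_tendsto_of_tendsto_of_monotone (μ := μ)
    (f := fun n x ↦ ENNReal.ofReal (b - g n x)) (F := fun x ↦ ((b : EReal) - f x).toENNReal)
    (fun n ↦ (measurable_const.sub (hgm n)).ennreal_ofReal.aemeasurable)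
    (Eventually.of_forall fun x n m hnm ↦ ENNReal.ofReal_le_ofReal (by linarith [hanti x hnm]))
    (Eventually.of_forall fun x ↦ by
      have h1 : Tendsto (fun n ↦ (b : EReal) + -(g n x : EReal)) atTop (𝓝 (b + -f x)) := by
        have h2 : Tendsto (fun n ↦ -(g n x : EReal)) atTop (𝓝 (-f x)) :=
          (continuous_neg.tendsto _).comp (hlim x)
        exact (EReal.continuousAt_add (p := ((b : EReal), -f x)) (by simp) (by simp)).tendsto.comp
          (tendsto_const_nhds.prodMk_nhds h2)
      have h3 := (EReal.continuous_toENNReal.tendsto _).comp h1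
      refine h3.congr fun n ↦ ?_
      simp only [Function.comp]
      rw [← sub_eq_add_neg, ← EReal.coe_sub, EReal.real_coe_toENNReal])
  refine le_of_tendsto hT (Eventually.of_forall fun n ↦ ?_)
  have hi : Integrable (fun x ↦ b - g n x) μ := (integrable_const _).sub (hgi n)
  rw [← ofReal_integral_eq_lintegral_ofReal hi
    (Eventually.of_forall fun x ↦ by simpa using hgb n x), hint]
  exact ENNReal.ofReal_le_ofReal (by linarith [hc n])

theorem ofReal_integral_le_lintegral {f : α → ℝ} (hf : Integrable f μ) :
    ENNReal.ofReal (∫ x, f x ∂μ) ≤ ∫⁻ x, ENNReal.ofReal (f x) ∂μ := by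
  rw [integral_eq_lintegral_pos_part_sub_lintegral_neg_part hf]
  exact (ENNReal.ofReal_le_ofReal (sub_le_self _ ENNReal.toReal_nonneg)).trans
    ENNReal.ofReal_toReal_le

theorem ofReal_add_le_lintegral [IsFiniteMeasure μ] {f g : α → EReal} (hf : Measurable f)
    {m : α → ℝ} (hm : Integrable m μ) {b d : ℝ} (hfb : ∀ᵐ x ∂μ, f x ≤ b) (hgd : ∀ᵐ x ∂μ, g x ≤ d)
    (hle : ∀ᵐ x ∂μ, f x + g x ≤ m x) :
    ENNReal.ofReal ((b + d) * μ.real Set.univ - ∫ x, m x ∂μ)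
      ≤ ∫⁻ x, ((b : EReal) - f x).toENNReal ∂μ + ∫⁻ x, ((d : EReal) - g x).toENNReal ∂μ := by
  have h1 : (b + d) * μ.real Set.univ - ∫ x, m x ∂μ = ∫ x, (b + d - m x) ∂μ := by
    rw [integral_sub (integrable_const _) hm]
    simp [mul_comm]
  rw [h1, ← lintegral_add_left (measurable_toENNReal_const_sub hf b)]
  have hi : Integrable (fun x ↦ b + d - m x) μ := (integrable_const _).sub hm
  refine (ofReal_integral_le_lintegral hi).trans (lintegral_mono_ae ?_)
  filter_upwards [hfb, hgd, hle] with x h3 h4 h5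
  generalize f x = p at *
  generalize g x = q at *
  induction p with
  | bot => simp
  | top => simp at h3
  | coe p =>
    induction q with
    | bot => simp
    | top => simp at h4
    | coe q =>
      norm_cast at h3 h4 h5
      rw [← EReal.coe_sub, ← EReal.coe_sub]
      simp only [EReal.real_coe_toENNReal]
      rw [← ENNReal.ofReal_add (by linarith) (by linarith)]
      exact ENNReal.ofReal_le_ofReal (by linarith)

theorem eintegral_le_of_add_le [IsFiniteMeasure μ] {f g : α → EReal} (hf : Measurable f)
    (hg : Measurable g) {m : α → ℝ} (hm : Integrable m μ) {b d c : ℝ} (hfb : ∀ᵐ x ∂μ, f x ≤ b)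
    (hgd : ∀ᵐ x ∂μ, g x ≤ d) (hle : ∀ᵐ x ∂μ, f x + g x ≤ m x) (hc : (c : EReal) ≤ eintegral μ g) :
    eintegral μ f ≤ ((∫ x, m x ∂μ - c : ℝ) : EReal) := by
  have h1 := ofReal_add_le_lintegral hf hm hfb hgd hle
  have h2 := lintegral_le_of_le_eintegral hg hgd hc
  have h3 : c ≤ d * μ.real Set.univ := by
    rw [eintegral_eq_sub hg hgd] at hc
    have : (c : EReal) ≤ ((d * μ.real Set.univ : ℝ) : EReal) :=
      hc.trans (by simpa using EReal.sub_le_sub le_rfl (EReal.coe_ennreal_nonneg _))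
    exact_mod_cast this
  rw [eintegral_eq_sub hf hfb]
  have h4 := h1.trans (add_le_add_right h2 _)
  generalize ∫⁻ x, ((b : EReal) - f x).toENNReal ∂μ = I at *
  induction I with
  | top => simp
  | coe I =>
    change _ - ((I : ℝ) : EReal) ≤ _
    rw [← ENNReal.ofReal_coe_nnreal, ← ENNReal.ofReal_add (by simp) (by linarith),
      ENNReal.ofReal_le_ofReal_iff (by linarith [I.coe_nonneg])] at h4
    rw [← EReal.coe_sub, EReal.coe_le_coe_iff]
    linarith

end Integral

theorem eintegral_map {α β : Type*} [MeasurableSpace α] [MeasurableSpace β] {μ : Measure α}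
    {e : α → β} (he : Measurable e) {f : β → EReal} (hf : Measurable f) :
    eintegral (μ.map e) f = eintegral μ (f ∘ e) := by
  unfold eintegral
  have hf' : Measurable fun x ↦ -f x := hf.neg
  rw [lintegral_map hf.ereal_toENNReal he, lintegral_map hf'.ereal_toENNReal he]
  rfl

/-- An upper semicontinuous function without the value `⊤` is bounded above on compact sets. -/
theorem exists_forall_le_of_upperSemicontinuous {X : Type*} [TopologicalSpace X] {f : X → EReal}
    (hf : UpperSemicontinuous f) (hf' : ∀ x, f x ≠ ⊤) {K : Set X} (hK : IsCompact K) :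
    ∃ b : ℝ, ∀ x ∈ K, f x ≤ b := by
  refine hK.induction_on (p := fun S ↦ ∃ b : ℝ, ∀ x ∈ S, f x ≤ b) ⟨0, by simp⟩
    (fun S T hST ⟨b, hb⟩ ↦ ⟨b, fun x hx ↦ hb x (hST hx)⟩) ?_ ?_
  · rintro S T ⟨b, hb⟩ ⟨d, hd⟩
    refine ⟨max b d, ?_⟩
    rintro x (hx | hx)
    · exact (hb x hx).trans (by exact_mod_cast le_max_left _ _)
    · exact (hd x hx).trans (by exact_mod_cast le_max_right _ _)
  · intro x _
    obtain ⟨b, hb⟩ := EReal.lt_iff_exists_real_btwn.1 (lt_top_iff_ne_top.2 (hf' x))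
    exact ⟨{y | f y < b}, mem_nhdsWithin_of_mem_nhds (hf x b hb.1), b, fun y hy ↦ le_of_lt hy⟩

section Approximation

variable {X : Type*} [PseudoMetricSpace X]

/-- The truncated Moreau envelope `min k (inf_y (F y + k d(x, y)))`. -/
def envelope (F : X → ENNReal) (k : ℕ) (x : X) : ENNReal :=
  min (k : ENNReal) (⨅ y, F y + k * edist x y)

theorem envelope_ne_top (F : X → ENNReal) (k : ℕ) (x : X) : envelope F k x ≠ ⊤ :=
  ne_top_of_le_ne_top (ENNReal.natCast_ne_top k) (min_le_left _ _)

theorem envelope_mono (F : X → ENNReal) (x : X) : Monotone fun k ↦ envelope F k x := by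
  intro k l hkl
  have : (k : ENNReal) ≤ l := by exact_mod_cast hkl
  exact min_le_min this (iInf_mono fun y ↦ by gcongr)

theorem continuous_envelope (F : X → ENNReal) (k : ℕ) :
    Continuous fun x ↦ (envelope F k x).toReal := by
  refine (LipschitzWith.of_le_add_mul (f := fun x ↦ (envelope F k x).toReal) (k : NNReal)
    fun x x' ↦ ?_).continuous
  have h : envelope F k x ≤ envelope F k x' + k * edist x x' := by
    unfold envelope
    rw [← min_add_add_right]
    refine min_le_min le_self_add ?_
    rw [ENNReal.iInf_add]
    refine iInf_mono fun y ↦ ?_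
    rw [add_assoc, ← mul_add]
    gcongr
    rw [add_comm]
    exact edist_triangle _ _ _
  have hx : envelope F k x' ≠ ⊤ := envelope_ne_top F k x'
  have hxx' : (k : ENNReal) * edist x x' ≠ ⊤ :=
    ENNReal.mul_ne_top (ENNReal.natCast_ne_top k) (edist_ne_top x x')
  have h2 := ENNReal.toReal_mono (ENNReal.add_ne_top.2 ⟨hx, hxx'⟩) h
  rw [ENNReal.toReal_add hx hxx'] at h2
  simpa [edist_dist, dist_nonneg] using h2

theorem tendsto_envelope {F : X → ENNReal} (hF : LowerSemicontinuous F) (x : X) :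
    Tendsto (fun k ↦ envelope F k x) atTop (𝓝 (F x)) := by
  have hle : ∀ k, envelope F k x ≤ F x := fun k ↦
    (min_le_right _ _).trans ((iInf_le _ x).trans (by simp))
  refine tendsto_order.2
    ⟨fun a ha ↦ ?_, fun a ha ↦ Eventually.of_forall fun k ↦ (hle k).trans_lt ha⟩
  obtain ⟨a', haa', ha'⟩ := exists_between ha
  have hfin : a' ≠ ⊤ := ne_top_of_lt ha'
  obtain ⟨δ, hδ, hball⟩ := EMetric.mem_nhds_iff.1 (hF x a' ha')
  obtain ⟨n, hn⟩ := ENNReal.exists_nat_mul_gt hδ.ne' hfin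
  obtain ⟨m, hm⟩ := ENNReal.exists_nat_gt hfin
  filter_upwards [eventually_ge_atTop n, eventually_ge_atTop m] with k hk hk'
  refine haa'.trans_le (le_min (hm.le.trans (by exact_mod_cast hk')) (le_iInf fun y ↦ ?_))
  rcases lt_or_ge (edist y x) δ with hy | hy
  · exact (le_of_lt (hball hy)).trans le_self_add
  · rw [edist_comm] at hy
    have : (n : ENNReal) ≤ k := by exact_mod_cast hk
    exact hn.le.trans ((mul_le_mul' this hy).trans le_add_self)

/-- An upper semicontinuous function that is bounded above is the limit of a decreasing sequence of
continuous functions. -/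
theorem exists_antitone_continuous_tendsto {f : X → EReal} (hf : UpperSemicontinuous f) {b : ℝ}
    (hb : ∀ x, f x ≤ b) :
    ∃ g : ℕ → X → ℝ, (∀ n, Continuous (g n)) ∧ (∀ n x, g n x ≤ b) ∧ (∀ x, Antitone fun n ↦ g n x) ∧
      ∀ x, Tendsto (fun n ↦ (g n x : EReal)) atTop (𝓝 (f x)) := by
  set F : X → ENNReal := fun x ↦ ((b : EReal) - f x).toENNReal with hFdef
  have hcont : ∀ e : EReal, ContinuousAt (fun y : EReal ↦ (b : EReal) - y) e := fun e ↦ by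
    simp_rw [sub_eq_add_neg]
    exact (EReal.continuousAt_add (p := ((b : EReal), -e)) (by simp) (by simp)).comp
      (f := fun y ↦ ((b : EReal), -y)) (by fun_prop)
  have hF : LowerSemicontinuous F := by
    refine Continuous.comp_upperSemicontinuous_antitone
      (g := fun y : EReal ↦ ((b : EReal) - y).toENNReal) ?_ hf ?_
    · exact EReal.continuous_toENNReal.comp (continuous_iff_continuousAt.2 hcont)
    · exact fun x y hxy ↦ EReal.toENNReal_le_toENNReal (EReal.sub_le_sub le_rfl hxy)
  refine ⟨fun n x ↦ b - (envelope F n x).toReal, fun n ↦ continuous_const.sub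
    (continuous_envelope F n), fun n x ↦ by simp, fun x n m hnm ↦ ?_, fun x ↦ ?_⟩
  · exact sub_le_sub_left (ENNReal.toReal_mono (envelope_ne_top F m x) (envelope_mono F x hnm)) b
  · have h1 : Tendsto (fun n ↦ (b : EReal) - (envelope F n x : EReal)) atTop
        (𝓝 ((b : EReal) - (F x : EReal))) :=
      (hcont _).tendsto.comp ((continuous_coe_ennreal_ereal.tendsto _).comp (tendsto_envelope hF x))
    have h2 : (b : EReal) - (F x : EReal) = f x := by
      have hbx := hb x
      simp only [hFdef]
      generalize f x = y at *
      induction y with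
      | bot => simp
      | top => simp at hbx
      | coe y =>
        rw [← EReal.coe_sub, EReal.coe_toENNReal (by norm_cast at hbx ⊢; linarith)]
        norm_cast
        ring
    rw [h2] at h1
    refine h1.congr fun n ↦ ?_
    rw [EReal.coe_sub, ← EReal.coe_ennreal_toReal (envelope_ne_top F n x)]

end Approximation

section Separation

theorem isOpen_setOf_forall_lt {X : Type*} [TopologicalSpace X] [CompactSpace X]
    (a : C(X, ℝ)) : IsOpen {f : C(X, ℝ) | ∀ x, a x < f x} := by
  have h := ContinuousMap.isOpen_setOfPred_mapsTo (X := X) isCompact_univ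
    (isOpen_Ioi (a := (0 : ℝ)))
  have hc : Continuous fun f : C(X, ℝ) ↦ f - a := continuous_id.sub continuous_const
  convert h.preimage hc using 1
  ext f
  simp [Set.MapsTo]

variable {X : Type*} [TopologicalSpace X] [CompactSpace X] [T2Space X] [MeasurableSpace X]
  [BorelSpace X]

/-- A positive linear functional on `C(X, ℝ)`, for compact `X`, is given by a finite measure. -/
theorem exists_measure_of_positive (ℓ : C(X, ℝ) →ₗ[ℝ] ℝ)
    (hℓ : ∀ f : C(X, ℝ), (∀ x, 0 ≤ f x) → 0 ≤ ℓ f) :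
    ∃ μ : Measure X, IsFiniteMeasure μ ∧ ∀ f : C(X, ℝ), ∫ x, f x ∂μ = ℓ f := by
  let φ : CompactlySupportedContinuousMap X ℝ →ₗ[ℝ] ℝ :=
    { toFun := fun f ↦ ℓ f.toContinuousMap
      map_add' := fun f g ↦ by rw [← map_add]; rfl
      map_smul' := fun c f ↦ by rw [← map_smul]; rfl }
  let Λ := PositiveLinearMap.mk₀ φ fun f hf ↦
    hℓ _ fun x ↦ CompactlySupportedContinuousMap.le_def.1 hf x
  refine ⟨RealRMK.rieszMeasure Λ, inferInstance, fun f ↦ ?_⟩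
  exact RealRMK.integral_rieszMeasure Λ (CompactlySupportedContinuousMap.continuousMapEquiv f)

/-- If a convex cone `A` of pairs `(a, t)` contains `(0, 0)` and `(-1, -1)`, and no pair with
`t > c` has its function strictly below a member of the convex set `N`, then some measure `μ`
satisfies `t ≤ ∫ a dμ` on `A` and `∫ f dμ ≤ c` on `N`. -/
theorem exists_measure_separating {A : Set (C(X, ℝ) × ℝ)} (hadd : ∀ p ∈ A, ∀ q ∈ A, p + q ∈ A)
    (hsmul : ∀ p ∈ A, ∀ t : ℝ, 0 < t → t • p ∈ A) (hzero : (0, 0) ∈ A) (hneg : (-1, -1) ∈ A)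
    {N : Set C(X, ℝ)} (hN : Convex ℝ N) (hN' : N.Nonempty) {c : ℝ}
    (hdisj : ∀ p ∈ A, ∀ f ∈ N, (∀ x, p.1 x < f x) → p.2 ≤ c) :
    ∃ μ : Measure X, IsFiniteMeasure μ ∧ (∀ p ∈ A, p.2 ≤ ∫ x, p.1 x ∂μ) ∧
      ∀ f ∈ N, ∫ x, f x ∂μ ≤ c := by
  set P : Set (C(X, ℝ) × ℝ) := {q | ∃ p ∈ A, (∀ x, p.1 x < q.1 x) ∧ q.2 < p.2} with hP
  have hPsmul : ∀ q ∈ P, ∀ t : ℝ, 0 < t → t • q ∈ P := by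
    rintro q ⟨p, hp, h1, h2⟩ t ht
    refine ⟨t • p, hsmul p hp t ht, fun x ↦ ?_, ?_⟩
    · simpa using mul_lt_mul_of_pos_left (h1 x) ht
    · simpa using mul_lt_mul_of_pos_left h2 ht
  have hPadd : ∀ q ∈ P, ∀ q' ∈ P, q + q' ∈ P := by
    rintro q ⟨p, hp, h1, h2⟩ q' ⟨p', hp', h1', h2'⟩
    exact ⟨p + p', hadd p hp p' hp', fun x ↦ add_lt_add (h1 x) (h1' x), add_lt_add h2 h2'⟩
  have hPconv : Convex ℝ P := convex_iff_forall_pos.2 fun q hq q' hq' a b ha hb _ ↦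
    hPadd _ (hPsmul q hq a ha) _ (hPsmul q' hq' b hb)
  have hPopen : IsOpen P := by
    have : P = ⋃ p ∈ A, {f : C(X, ℝ) | ∀ x, p.1 x < f x} ×ˢ Set.Iio p.2 := by
      ext q
      simp only [hP, Set.mem_ofPred_eq, Set.mem_iUnion, Set.mem_prod, Set.mem_Iio, exists_prop]
    rw [this]
    exact isOpen_biUnion fun p _ ↦ (isOpen_setOf_forall_lt p.1).prod isOpen_Iio
  have hD : Disjoint P (N ×ˢ {c}) := by
    rw [Set.disjoint_left]
    rintro ⟨f, t⟩ ⟨p, hp, h1, h2⟩ ⟨hf, ht⟩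
    simp only [Set.mem_singleton_iff] at ht
    exact absurd (hdisj p hp f hf h1) (by simpa [ht] using h2)
  obtain ⟨L, s, hLP, hLN⟩ := geometric_hahn_banach_open hPconv hPopen
    (hN.prod (convex_singleton c)) hD
  have hp0 : ((1, -1) : C(X, ℝ) × ℝ) ∈ P := ⟨_, hzero, by simp, by simp⟩
  have hLP0 : ∀ q ∈ P, L q ≤ 0 := by
    intro q hq
    by_contra! hcon
    have h1 := hLP _ (hPsmul q hq (|s| / L q + 1) (by positivity))
    rw [map_smul, smul_eq_mul, add_mul, div_mul_cancel₀ _ hcon.ne'] at h1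
    linarith [le_abs_self s]
  have hs : 0 ≤ s := by
    by_contra! hcon
    have h0 := hLP _ hp0
    have hneg' : L (1, -1) < 0 := h0.trans hcon
    have h1 := hLP _ (hPsmul _ hp0 (s / (2 * L (1, -1)))
      (div_pos_of_neg_of_neg hcon (by linarith)))
    rw [map_smul, smul_eq_mul, div_mul_eq_mul_div, mul_comm s, mul_comm (2 : ℝ),
      mul_div_mul_left _ _ hneg'.ne] at h1
    linarith
  set ℓ : C(X, ℝ) →ₗ[ℝ] ℝ := (L : C(X, ℝ) × ℝ →ₗ[ℝ] ℝ) ∘ₗ LinearMap.inl ℝ _ _ with hℓ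
  set a := L (0, 1) with ha
  have hdec : ∀ f t, L (f, t) = ℓ f + t * a := by
    intro f t
    have : ((f, t) : C(X, ℝ) × ℝ) = (f, 0) + t • (0, 1) := by ext <;> simp
    rw [this, map_add, map_smul, smul_eq_mul]
    simp [hℓ, ha]
  have hkey : ∀ p ∈ A, ∀ f : C(X, ℝ), (∀ x, p.1 x ≤ f x) → ℓ f + p.2 * a ≤ 0 := by
    intro p hp f hf
    by_contra! hcon
    set δ := ℓ f + p.2 * a
    set κ := ℓ 1 - a
    set η := δ / (2 * (|κ| + 1))
    have hη : 0 < η := by positivity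
    have h1 := hLP0 (f + η • 1, p.2 - η) ⟨p, hp, fun x ↦ by
      simpa using (hf x).trans_lt (lt_add_of_pos_right _ hη), by simpa using hη⟩
    rw [hdec, map_add, map_smul, smul_eq_mul] at h1
    have h2 : δ + η * κ ≤ 0 := by simp only [δ, κ]; linarith
    have h3 : η * |κ| ≤ δ / 2 := by
      have : η * (|κ| + 1) = δ / 2 := by simp only [η]; field_simp
      nlinarith
    have h4 : -(η * |κ|) ≤ η * κ := by nlinarith [neg_abs_le κ]
    linarith
  have ha0 : 0 ≤ a := by
    by_contra! hcon
    have h1 := hLP0 (1, -(|ℓ 1| / |a| + 1)) ⟨_, hzero, by simp, by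
      simp only [Left.neg_neg_iff]; positivity⟩
    rw [hdec] at h1
    have h2 : |ℓ 1| / |a| * a = -|ℓ 1| := by
      rw [abs_of_neg hcon, div_neg, neg_mul, div_mul_cancel₀ _ hcon.ne]
    nlinarith [neg_abs_le (ℓ 1)]
  have hbelow : ∀ f : C(X, ℝ), a = 0 → ℓ f ≤ 0 := by
    intro f h0
    have h1 := hkey ((‖f‖ + 1) • (-1, -1)) (hsmul _ hneg _ (by positivity)) f fun x ↦ by
      have := (abs_le.1 ((Real.norm_eq_abs _).symm.le.trans (f.norm_coe_le_norm x))).1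
      simp; linarith
    simpa [h0] using h1
  have hapos : 0 < a := by
    refine lt_of_le_of_ne ha0 fun h0 ↦ ?_
    have hℓ0 : ∀ f, ℓ f = 0 := fun f ↦ le_antisymm (hbelow f h0.symm) (by
      have := hbelow (-f) h0.symm
      rw [map_neg] at this; linarith)
    obtain ⟨f, hf⟩ := hN'
    have h1 := hLN (f, c) ⟨hf, rfl⟩
    have h2 := hLP _ hp0
    rw [hdec, hℓ0, ← h0] at h1 h2
    simp at h1 h2
    linarith
  obtain ⟨μ, hμ, hint⟩ := exists_measure_of_positive (-(a⁻¹ • ℓ)) fun f hf ↦ by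
    have := hkey (0, 0) hzero f (by simpa using hf)
    simp only [zero_mul, add_zero] at this
    simpa using mul_nonpos_of_nonneg_of_nonpos (inv_nonneg.2 ha0) this
  refine ⟨μ, hμ, fun p hp ↦ ?_, fun f hf ↦ ?_⟩
  · have := hkey p hp p.1 fun _ ↦ le_rfl
    rw [hint]
    simp only [LinearMap.neg_apply, LinearMap.smul_apply, smul_eq_mul]
    rw [← mul_neg, inv_mul_eq_div, le_div_iff₀ hapos]
    linarith
  · have := hs.trans (hLN (f, c) ⟨hf, rfl⟩)
    rw [hdec] at this
    rw [hint]
    simp only [LinearMap.neg_apply, LinearMap.smul_apply, smul_eq_mul]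
    rw [← mul_neg, inv_mul_eq_div, div_le_iff₀ hapos]
    linarith

end Separation

section Cone

variable {G : Set ℂ} {H : Set (G → EReal)}

theorem IsJensenMeasure.isFiniteMeasure {o : G} {μ : Measure G} (hμ : IsJensenMeasure o H μ) :
    IsFiniteMeasure μ := by
  obtain ⟨K, hK, hK0⟩ := hμ.compact_support
  have := hμ.finite_on_compacts
  refine ⟨?_⟩
  rw [← Set.union_compl_self K]
  exact (measure_union_le _ _).trans_lt (by rw [hK0, add_zero]; exact hK.measure_lt_top)

theorem eintegral_le_of_forall_add_le {o : G} {u v : G → EReal} (hu : IsSubharmonic u)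
    (hH : ∀ h ∈ H, IsSubharmonic h) (hv : v ∈ H) (hvo : v o ≠ ⊥) {M : G → ℝ} (hM : Continuous M)
    (hle : ∀ z, u z + v z ≤ M z) {μ : Measure G} (hμ : IsJensenMeasure o H μ) :
    eintegral μ u ≤ (((∫ z, M z ∂μ) + -(v o).toReal : ℝ) : EReal) := by
  have := hμ.isFiniteMeasure
  have hv' := hH v hv
  obtain ⟨K, hK, hK0⟩ := hμ.compact_support
  have hKae : ∀ᵐ z ∂μ, z ∈ K := mem_ae_iff.2 hK0
  obtain ⟨b, hb⟩ :=
    exists_forall_le_of_upperSemicontinuous hu.upperSemicontinuous hu.ne_top hK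
  obtain ⟨d, hd⟩ :=
    exists_forall_le_of_upperSemicontinuous hv'.upperSemicontinuous hv'.ne_top hK
  have hMi : Integrable M μ := by
    rw [← Measure.restrict_eq_self_of_ae_mem hKae]
    exact hM.continuousOn.integrableOn_compact hK
  rw [← sub_eq_add_neg]
  refine eintegral_le_of_add_le hu.upperSemicontinuous.measurable
    hv'.upperSemicontinuous.measurable hMi (hKae.mono hb) (hKae.mono hd) (.of_forall hle) ?_
  rw [EReal.coe_toReal (hv'.ne_top o) hvo]
  exact hμ.le_integral v hv

/-- The continuous real-valued functions in `H`. -/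
def continuousPart (H : Set (G → EReal)) : Set (G → ℝ) :=
  {h | Continuous h ∧ (fun z ↦ (h z : EReal)) ∈ H}

theorem IsConeOfSubharmonic.continuousPart_add_mem (hH : IsConeOfSubharmonic H) {f g : G → ℝ}
    (hf : f ∈ continuousPart H) (hg : g ∈ continuousPart H) : f + g ∈ continuousPart H :=
  ⟨hf.1.add hg.1, by simpa using hH.add_mem _ hf.2 _ hg.2⟩

theorem IsConeOfSubharmonic.continuousPart_smul_mem (hH : IsConeOfSubharmonic H) {f : G → ℝ}
    (hf : f ∈ continuousPart H) {t : ℝ} (ht : 0 < t) : t • f ∈ continuousPart H :=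
  ⟨hf.1.const_smul t, by simpa using hH.smul_mem _ hf.2 t ht⟩

theorem IsConeOfSubharmonic.convex_continuousPart (hH : IsConeOfSubharmonic H) :
    Convex ℝ (continuousPart H) :=
  convex_iff_forall_pos.2 fun _ hf _ hg _ _ ha hb _ ↦
    hH.continuousPart_add_mem (hH.continuousPart_smul_mem hf ha) (hH.continuousPart_smul_mem hg hb)

theorem convex_setOf_add_le (y : EReal) (m : ℝ) : Convex ℝ {a : ℝ | y + a ≤ m} := by
  induction y with
  | bot => simpa using convex_univ
  | top => simpa using convex_empty
  | coe y =>
    have : {a : ℝ | (y : EReal) + a ≤ m} = Set.Iic (m - y) := by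
      ext a
      simp only [Set.mem_ofPred_eq, Set.mem_Iic]
      norm_cast
      constructor <;> intro h <;> linarith
    rw [this]
    exact convex_Iic _

theorem exists_mem_continuousPart_add_le (hH : IsConeOfSubharmonic H)
    (hzero : (fun _ ↦ (0 : EReal)) ∈ H) (hneg : (fun _ ↦ (-1 : EReal)) ∈ H)
    (happrox : HasContinuousApprox H) {o : G} {u : G → EReal} (hu : UpperSemicontinuous u)
    (hu' : ∀ z, u z ≠ ⊤) {M : G → ℝ} (hM : Continuous M) {C : ℝ}
    (hC : ∀ μ : Measure G, IsJensenMeasure o H μ →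
      eintegral μ u ≤ (((∫ z, M z ∂μ) + C : ℝ) : EReal)) {K : Set G} (hK : IsCompact K) :
    ∃ h ∈ continuousPart H, -(C + 1) < h o ∧ ∀ z ∈ K, u z + h z ≤ M z := by
  have : CompactSpace K := isCompact_iff_compactSpace.1 hK
  obtain ⟨b, hb⟩ := exists_forall_le_of_upperSemicontinuous hu hu' hK
  set A : Set (C(K, ℝ) × ℝ) := {p | ∃ h ∈ continuousPart H, (∀ x : K, p.1 x = h x) ∧ p.2 = h o}
    with hA
  set N : Set C(K, ℝ) := {f | ∀ x : K, u x + f x ≤ M x} with hN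
  let MK : C(K, ℝ) := ⟨fun x ↦ M x, hM.comp continuous_subtype_val⟩
  have hmemN : ∀ g : C(K, ℝ), (∀ x : K, u x ≤ g x) → MK - g ∈ N := fun g hg x ↦ by
    have hgx := hg x
    change u x + ((M x - g x : ℝ) : EReal) ≤ M x
    generalize u x = y at *
    induction y with
    | bot => simp
    | top => simp at hgx
    | coe y => norm_cast at hgx ⊢; linarith
  by_contra! hcon
  obtain ⟨μ, hμ, hμA, hμN⟩ := exists_measure_separating (A := A) (N := N) (c := -(C + 1))
    (by
      rintro p ⟨h, hh, h1, h2⟩ q ⟨k, hk, k1, k2⟩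
      exact ⟨h + k, hH.continuousPart_add_mem hh hk, fun x ↦ by simp [h1, k1], by simp [h2, k2]⟩)
    (by
      rintro p ⟨h, hh, h1, h2⟩ t ht
      exact ⟨t • h, hH.continuousPart_smul_mem hh ht, fun x ↦ by simp [h1], by simp [h2]⟩)
    ⟨0, ⟨continuous_const, by simpa using hzero⟩, by simp, by simp⟩
    ⟨fun _ ↦ -1, ⟨continuous_const, by simpa using hneg⟩, by simp, by simp⟩
    (by
      intro f hf g hg s t hs ht hst x
      exact convex_setOf_add_le (u x) (M x) (hf x) (hg x) hs ht hst)
    ⟨_, hmemN (ContinuousMap.const K b) fun x ↦ by simpa using hb x x.2⟩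
    (by
      rintro p ⟨h, hh, h1, h2⟩ f hf hlt
      rw [h2]
      by_contra! hlo
      obtain ⟨z, hz, hzM⟩ := hcon h hh hlo
      have h3 := hf ⟨z, hz⟩
      have h4 := hlt ⟨z, hz⟩
      rw [h1] at h4
      refine absurd (le_trans ?_ h3) hzM.not_ge
      exact add_le_add_right (by exact_mod_cast h4.le) _)
  have hint : ∀ g : C(K, ℝ), Integrable g μ := fun g ↦
    g.continuous.integrable_of_hasCompactSupport (.of_compactSpace _)
  set ν : Measure G := μ.map Subtype.val with hν
  have hval : Measurable (Subtype.val : K → G) := measurable_subtype_coe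
  have hJ : IsJensenMeasure o H ν := by
    refine ⟨⟨fun _ _ ↦ measure_lt_top _ _⟩, ⟨K, hK, ?_⟩, fun h hh ↦ ?_⟩
    · rw [hν, Measure.map_apply hval hK.measurableSet.compl]
      simp
    · obtain ⟨g, hgc, hgH, hganti, hglim⟩ := happrox h hh
      rw [hν, eintegral_map hval (hH.isSubharmonic h hh).upperSemicontinuous.measurable]
      by_cases hbot : h o = ⊥
      · simp [hbot]
      rw [← EReal.coe_toReal ((hH.isSubharmonic h hh).ne_top o) hbot]
      let gK : ℕ → C(K, ℝ) := fun n ↦ ⟨fun x ↦ g n x, (hgc n).comp continuous_subtype_val⟩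
      refine le_eintegral_of_antitone_tendsto (g := fun n (x : K) ↦ g n x) (b := ‖gK 0‖)
        (fun n ↦ hint (gK n)) (fun n ↦ (gK n).continuous.measurable)
        (fun x ↦ (le_abs_self _).trans ((gK 0).norm_coe_le_norm x)) (fun x ↦ hganti x)
        (fun x ↦ hglim x) fun n ↦ ?_
      refine le_trans ?_ (hμA (gK n, g n o) ⟨g n, ⟨hgc n, hgH n⟩, fun _ ↦ rfl, rfl⟩)
      have h1 : h o ≤ g n o := by
        refine le_of_tendsto (hglim o) ?_
        filter_upwards [eventually_ge_atTop n] with m hm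
        exact_mod_cast hganti o hm
      rw [← EReal.coe_toReal ((hH.isSubharmonic h hh).ne_top o) hbot] at h1
      exact_mod_cast h1
  obtain ⟨g, hgc, hgb, hganti, hglim⟩ := exists_antitone_continuous_tendsto (X := K)
    (f := fun x ↦ u x) (fun x y hy ↦ continuous_subtype_val.continuousAt.eventually (hu x y hy))
    (b := b) fun x ↦ hb x x.2
  let gK : ℕ → C(K, ℝ) := fun n ↦ ⟨g n, hgc n⟩
  have h1 := hC ν hJ
  rw [hν, eintegral_map hval hu.measurable,
    integral_map hval.aemeasurable hM.aestronglyMeasurable] at h1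
  have h2 : ((∫ x, MK x ∂μ + (C + 1) : ℝ) : EReal) ≤ eintegral μ (u ∘ Subtype.val) := by
    refine le_eintegral_of_antitone_tendsto (g := g) (b := b) (fun n ↦ hint (gK n))
      (fun n ↦ (hgc n).measurable) (hgb 0) hganti hglim fun n ↦ ?_
    have h3 := hμN _ (hmemN (gK n) fun x ↦ le_of_tendsto (hglim x) ?_)
    · have h4 : ∫ x, (MK - gK n) x ∂μ = ∫ x, MK x ∂μ - ∫ x, g n x ∂μ :=
        integral_sub (hint MK) (hint (gK n))
      linarith
    · filter_upwards [eventually_ge_atTop n] with m hm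
      exact_mod_cast hganti x hm
  have h3 := h2.trans h1
  have h4 : ∫ x, MK x ∂μ + (C + 1) ≤ (∫ x : K, M x ∂μ) + C := by exact_mod_cast h3
  have h5 : ∫ x, MK x ∂μ = ∫ x : K, M x ∂μ := rfl
  linarith

end Cone

instance : IsProbabilityMeasure angleMeasure := by
  refine ⟨?_⟩
  have h : (0 : ℝ) < 2 * Real.pi := by positivity
  rw [angleMeasure, Measure.smul_apply, Measure.restrict_apply_univ, Real.volume_Ioc, sub_zero,
    smul_eq_mul, ← ENNReal.ofReal_mul (by positivity), inv_mul_cancel₀ h.ne', ENNReal.ofReal_one]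

theorem lintegral_polar {g : ℂ → ENNReal} (hg : Measurable g) (z : ℂ) :
    ∫⁻ w, g w = ∫⁻ r in Set.Ioi (0 : ℝ), ENNReal.ofReal (2 * Real.pi * r) *
      ∫⁻ θ, g (circleMap z r θ) ∂angleMeasure := by
  have hpi : (0 : ℝ) < 2 * Real.pi := by positivity
  have hmeas : Measurable fun p : ℝ × ℝ ↦
      ENNReal.ofReal p.1 • g (z - Complex.polarCoord.symm p) := by
    simp_rw [Complex.polarCoord_symm_apply, smul_eq_mul]
    exact (by fun_prop : Measurable fun p : ℝ × ℝ ↦ ENNReal.ofReal p.1).mul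
      (hg.comp (by fun_prop))
  rw [← lintegral_sub_left_eq_self g z, ← Complex.lintegral_comp_polarCoord_symm, polarCoord_target,
    Measure.volume_eq_prod, ← Measure.prod_restrict, lintegral_prod _ hmeas.aemeasurable]
  refine lintegral_congr fun r ↦ ?_
  have hshift : ∫⁻ θ in Set.Ioc 0 (2 * Real.pi), g (circleMap z r θ)
      = ∫⁻ θ in Set.Ioo (-Real.pi) Real.pi, g (z - Complex.polarCoord.symm (r, θ)) := by
    rw [Measure.restrict_congr_set Ioo_ae_eq_Ioc,
      ← (measurePreserving_sub_right volume Real.pi).setLIntegral_comp_preimage_emb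
        (MeasurableEquiv.subRight Real.pi).measurableEmbedding
        (fun θ ↦ g (z - Complex.polarCoord.symm (r, θ)))]
    have hpre : (fun x ↦ x - Real.pi) ⁻¹' Set.Ioc (-Real.pi) Real.pi = Set.Ioc 0 (2 * Real.pi) := by
      ext x
      simp only [Set.mem_preimage, Set.mem_Ioc]
      constructor <;> rintro ⟨h1, h2⟩ <;> constructor <;> linarith
    rw [hpre]
    refine lintegral_congr fun θ ↦ ?_
    congr 1
    rw [Complex.polarCoord_symm_apply, circleMap, Real.cos_sub_pi, Real.sin_sub_pi,
      Complex.exp_mul_I]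
    push_cast
    ring
  have hm : Measurable fun θ ↦ g (z - Complex.polarCoord.symm (r, θ)) := by
    simp_rw [Complex.polarCoord_symm_apply]
    exact hg.comp (by fun_prop)
  simp_rw [smul_eq_mul]
  rw [lintegral_const_mul _ hm, angleMeasure, lintegral_smul_measure, hshift, smul_eq_mul,
    ← mul_assoc]
  congr 1
  rw [mul_comm (2 * Real.pi), ENNReal.ofReal_mul' hpi.le, mul_assoc,
    ← ENNReal.ofReal_mul hpi.le, mul_inv_cancel₀ hpi.ne', ENNReal.ofReal_one, mul_one]

/-- The sub-mean value property over discs inside `G`, written for `b - U ≥ 0` so that it makes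
sense without integrability. -/
def HasAreaSubmean (G : Set ℂ) (U : ℂ → EReal) : Prop :=
  ∀ (z : ℂ) (r b : ℝ), 0 < r → Metric.closedBall z r ⊆ G → (∀ w ∈ Metric.closedBall z r, U w ≤ b) →
    ∫⁻ w in Metric.closedBall z r, ((b : EReal) - U w).toENNReal
      ≤ ((b : EReal) - U z).toENNReal * volume (Metric.closedBall z r)

theorem IsSubharmonic.hasAreaSubmean {G : Set ℂ} {U : ℂ → EReal} (hUm : Measurable U)
    (hU : IsSubharmonic fun z : G ↦ U z) : HasAreaSubmean G U := by
  intro z R b hR hball hb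
  have hz : z ∈ Metric.closedBall z R := Metric.mem_closedBall_self hR.le
  have hms : MeasurableSet (Metric.closedBall z R) := measurableSet_closedBall
  rw [← setLIntegral_const, ← lintegral_indicator hms, ← lintegral_indicator hms,
    lintegral_polar ((measurable_toENNReal_const_sub hUm b).indicator hms) z,
    lintegral_polar (measurable_const.indicator hms) z]
  refine setLIntegral_mono' measurableSet_Ioi fun r (hr : 0 < r) ↦ ?_
  gcongr ENNReal.ofReal _ * ?_
  by_cases hrR : r ≤ R
  · have hmem : ∀ θ, circleMap z r θ ∈ Metric.closedBall z R := fun θ ↦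
      Metric.closedBall_subset_closedBall hrR (circleMap_mem_closedBall z hr.le θ)
    simp only [Set.indicator_of_mem (hmem _), lintegral_const, measure_univ, mul_one]
    by_cases hbot : U z = ⊥
    · simp [hbot]
    have hsub := hU.le_circleMean ⟨z, hball hz⟩ r hr
      ((Metric.closedBall_subset_closedBall hrR).trans hball)
    simp only at hsub
    have htop := hU.ne_top ⟨z, hball hz⟩
    simp only at htop
    rw [← EReal.coe_toReal htop hbot] at hsub ⊢
    have h1 := lintegral_le_of_le_eintegral
      (hUm.comp (continuous_circleMap z r).measurable) (b := b) (.of_forall fun θ ↦ hb _ (hmem θ))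
      hsub
    simpa [← EReal.coe_sub] using h1
  · have hmem : ∀ θ, circleMap z r θ ∉ Metric.closedBall z R := fun θ ↦ by
      simpa [circleMap, abs_of_pos hr] using hrR
    simp [Set.indicator_of_notMem (hmem _)]

theorem toENNReal_neg_le (b : ℝ) (x : EReal) :
    (-x).toENNReal ≤ ((b : EReal) - x).toENNReal + ENNReal.ofReal (-b) := by
  induction x with
  | bot => simp
  | top => simp
  | coe x =>
    rw [← EReal.coe_sub, ← EReal.coe_neg]
    simp only [EReal.real_coe_toENNReal]
    refine le_trans (ENNReal.ofReal_le_ofReal ?_) ENNReal.ofReal_add_le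
    linarith

theorem toENNReal_const_sub_le (b : ℝ) (x : EReal) :
    ((b : EReal) - x).toENNReal ≤ (-x).toENNReal + ENNReal.ofReal b := by
  rw [sub_eq_add_neg, add_comm]
  simpa using EReal.toENNReal_add_le (x := -x) (y := (b : EReal))

theorem HasAreaSubmean.lintegral_neg_le {G : Set ℂ} {U : ℂ → EReal} (hU : HasAreaSubmean G U)
    {z : ℂ} {r b : ℝ} (hr : 0 < r) (hball : Metric.closedBall z r ⊆ G)
    (hb : ∀ w ∈ Metric.closedBall z r, U w ≤ b) :
    ∫⁻ w in Metric.closedBall z r, (-U w).toENNReal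
      ≤ (((b : EReal) - U z).toENNReal + ENNReal.ofReal (-b)) * volume (Metric.closedBall z r) := by
  refine (lintegral_mono fun w ↦ toENNReal_neg_le b (U w)).trans ?_
  rw [lintegral_add_right _ measurable_const, setLIntegral_const, add_mul]
  gcongr
  exact hU z r b hr hball hb

/-- A family of functions with the sub-mean value property in a domain which is locally bounded
above and bounded below at one point is bounded in `L¹_loc`. -/
theorem exists_lintegral_neg_le {ι : Type*} {G : Set ℂ} (hGo : IsOpen G) (hGc : IsConnected G)
    {U : ι → ℂ → EReal} (hUm : ∀ i, Measurable (U i)) (hU : ∀ i, HasAreaSubmean G (U i))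
    (hbdd : ∀ K ⊆ G, IsCompact K → ∃ b : ℝ, ∀ i, ∀ z ∈ K, U i z ≤ b) {o : ℂ} (ho : o ∈ G) {c : ℝ}
    (hc : ∀ i, c ≤ U i o) {K : Set ℂ} (hKG : K ⊆ G) (hK : IsCompact K) :
    ∃ C : ENNReal, C ≠ ⊤ ∧ ∀ i, ∫⁻ z in K, (-U i z).toENNReal ≤ C := by
  set S : Set ℂ := {z | ∃ r > 0, ∃ C : ENNReal, C ≠ ⊤ ∧
    ∀ i, ∫⁻ w in Metric.closedBall z r, (-U i w).toENNReal ≤ C} with hS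
  have hSopen : IsOpen S := by
    refine Metric.isOpen_iff.2 fun z ⟨r, hr, C, hC, h⟩ ↦ ⟨r, hr, fun y hy ↦ ?_⟩
    refine ⟨r - dist y z, by simpa using hy, C, hC, fun i ↦ le_trans ?_ (h i)⟩
    exact lintegral_mono_set (Metric.closedBall_subset_closedBall' (by linarith))
  have hoS : (G ∩ S).Nonempty := by
    obtain ⟨r, hr, hball⟩ := Metric.nhds_basis_closedBall.mem_iff.1 (hGo.mem_nhds ho)
    obtain ⟨b, hb⟩ := hbdd _ hball (isCompact_closedBall o r)
    refine ⟨o, ho, r, hr, (ENNReal.ofReal (b - c) + ENNReal.ofReal (-b)) *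
      volume (Metric.closedBall o r), ?_, fun i ↦ ?_⟩
    · have := (isCompact_closedBall o r).measure_ne_top (μ := volume)
      finiteness
    · refine ((hU i).lintegral_neg_le hr hball (hb i)).trans ?_
      gcongr
      rw [← EReal.real_coe_toENNReal, EReal.coe_sub]
      exact EReal.toENNReal_le_toENNReal (EReal.sub_le_sub le_rfl (hc i))
  have hScl : closure S ∩ G ⊆ S := by
    rintro z ⟨hzS, hzG⟩
    obtain ⟨R, hR, hball⟩ := Metric.nhds_basis_closedBall.mem_iff.1 (hGo.mem_nhds hzG)
    set ρ := R / 5 with hρ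
    have hρ0 : 0 < ρ := by positivity
    obtain ⟨b, hb⟩ := hbdd _ hball (isCompact_closedBall z R)
    obtain ⟨z', ⟨r, hr, C, hC, h⟩, hz'⟩ := Metric.mem_closure_iff.1 hzS ρ hρ0
    set s := min r ρ
    have hs : 0 < s := lt_min hr hρ0
    have hvs : volume (Metric.closedBall z' s) ≠ ⊤ := (isCompact_closedBall z' s).measure_ne_top
    have hvs0 : volume (Metric.closedBall z' s) ≠ 0 :=
      (Metric.measure_closedBall_pos volume z' hs).ne'
    set D := C + ENNReal.ofReal b * volume (Metric.closedBall z' s) with hD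
    refine ⟨ρ, hρ0, (D / volume (Metric.closedBall z' s) + ENNReal.ofReal (-b)) *
      volume (Metric.closedBall z (3 * ρ)), ?_, fun i ↦ ?_⟩
    · have := (isCompact_closedBall z (3 * ρ)).measure_ne_top (μ := volume)
      have : D / volume (Metric.closedBall z' s) ≠ ⊤ := ENNReal.div_ne_top (by finiteness) hvs0
      finiteness
    · have h1 : ∫⁻ w in Metric.closedBall z' s, ((b : EReal) - U i w).toENNReal ≤ D := by
        refine (lintegral_mono fun w ↦ toENNReal_const_sub_le b (U i w)).trans ?_
        rw [lintegral_add_right _ measurable_const, setLIntegral_const, hD]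
        gcongr
        exact (lintegral_mono_set (Metric.closedBall_subset_closedBall (min_le_left r ρ))).trans
          (h i)
      obtain ⟨w, hw, hwle⟩ := exists_le_setLAverage hvs0 hvs
        (measurable_toENNReal_const_sub (hUm i) b).aemeasurable
      rw [setLAverage_eq] at hwle
      have hw' : dist w z ≤ 2 * ρ := by
        have := dist_triangle w z' z
        rw [dist_comm z] at hz'
        have : dist w z' ≤ ρ := (Metric.mem_closedBall.1 hw).trans (min_le_right r ρ)
        linarith
      have hwR : Metric.closedBall w (3 * ρ) ⊆ Metric.closedBall z R :=
        Metric.closedBall_subset_closedBall' (by linarith)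
      have hzw : Metric.closedBall z ρ ⊆ Metric.closedBall w (3 * ρ) :=
        Metric.closedBall_subset_closedBall' (by rw [dist_comm]; linarith)
      have hvol : volume (Metric.closedBall w (3 * ρ)) = volume (Metric.closedBall z (3 * ρ)) := by
        simp [Complex.volume_closedBall]
      refine (lintegral_mono_set hzw).trans (((hU i).lintegral_neg_le (b := b) (by positivity)
        (hwR.trans hball) fun y hy ↦ hb i y (hwR hy)).trans ?_)
      rw [hvol]
      gcongr
      exact hwle.trans (ENNReal.div_le_div_right h1 _)
  have hGS : G ⊆ S := hGc.isPreconnected.subset_of_closure_inter_subset hSopen hoS hScl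
  refine hK.induction_on (p := fun T ↦ ∃ C : ENNReal, C ≠ ⊤ ∧
    ∀ i, ∫⁻ z in T, (-U i z).toENNReal ≤ C) ⟨0, by simp⟩
    (fun T T' hT ⟨C, hC, h⟩ ↦ ⟨C, hC, fun i ↦ (lintegral_mono_set hT).trans (h i)⟩)
    (fun T T' ⟨C, hC, h⟩ ⟨C', hC', h'⟩ ↦ ⟨C + C', by finiteness, fun i ↦
      (lintegral_union_le _ _ _).trans (add_le_add (h i) (h' i))⟩) fun z hz ↦ ?_
  obtain ⟨r, hr, C, hC, h⟩ := hGS (hKG hz)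
  exact ⟨_, mem_nhdsWithin_of_mem_nhds (Metric.closedBall_mem_nhds z hr), C, hC, h⟩

/-- The kernel of the averaging operator over discs of radius `ε`. -/
def discKernel (ε : ℝ) (z w : ℂ) : ℝ := Set.indicator {p : ℂ × ℂ | dist p.1 p.2 ≤ ε}
  (fun _ ↦ (Real.pi * ε ^ 2)⁻¹) (z, w)

/-- The mean of `f` over the disc of radius `ε` about `z`. -/
def discMean (ε : ℝ) (f : ℂ → ℝ) (z : ℂ) : ℝ := ∫ w, discKernel ε z w * f w

theorem discKernel_comm (ε : ℝ) (z w : ℂ) : discKernel ε z w = discKernel ε w z := by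
  simp [discKernel, Set.indicator_apply, dist_comm]

theorem measurable_discKernel (ε : ℝ) : Measurable fun p : ℂ × ℂ ↦ discKernel ε p.1 p.2 :=
  Measurable.indicator measurable_const
    (isClosed_le (by fun_prop) continuous_const).measurableSet

theorem discKernel_nonneg (ε : ℝ) (z w : ℂ) : 0 ≤ discKernel ε z w :=
  Set.indicator_nonneg (fun _ _ ↦ by positivity) _

theorem discKernel_le (ε : ℝ) (z w : ℂ) : discKernel ε z w ≤ (Real.pi * ε ^ 2)⁻¹ :=
  Set.indicator_le_self' (fun _ _ ↦ by positivity) _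

theorem discKernel_mul_eq (ε : ℝ) (f : ℂ → ℝ) (z w : ℂ) :
    discKernel ε z w * f w
      = (Metric.closedBall z ε).indicator (fun w ↦ (Real.pi * ε ^ 2)⁻¹ * f w) w := by
  by_cases h : dist w z ≤ ε
  · rw [Set.indicator_of_mem (by simpa using h), discKernel,
      Set.indicator_of_mem (by simpa [dist_comm] using h)]
  · rw [Set.indicator_of_notMem (by simpa using h), discKernel,
      Set.indicator_of_notMem (by simpa [dist_comm] using h), zero_mul]

theorem discMean_eq (ε : ℝ) (f : ℂ → ℝ) (z : ℂ) :
    discMean ε f z = (Real.pi * ε ^ 2)⁻¹ * ∫ w in Metric.closedBall z ε, f w := by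
  unfold discMean
  simp_rw [discKernel_mul_eq]
  rw [integral_indicator measurableSet_closedBall, integral_const_mul]

theorem volume_real_closedBall (z : ℂ) {ε : ℝ} (hε : 0 ≤ ε) :
    volume.real (Metric.closedBall z ε) = Real.pi * ε ^ 2 := by
  simp [Measure.real, Complex.volume_closedBall, hε, mul_comm]

theorem discMean_congr {ε : ℝ} {f g : ℂ → ℝ} {z : ℂ} {L : Set ℂ} (hL : Metric.closedBall z ε ⊆ L)
    (hfg : Set.EqOn f g L) : discMean ε f z = discMean ε g z := by
  rw [discMean_eq, discMean_eq,
    setIntegral_congr_fun measurableSet_closedBall fun w hw ↦ hfg (hL hw)]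

theorem discMean_const {ε : ℝ} (hε : 0 < ε) (c : ℝ) (z : ℂ) : discMean ε (fun _ ↦ c) z = c := by
  rw [discMean_eq, setIntegral_const, volume_real_closedBall z hε.le, smul_eq_mul,
    inv_mul_cancel_left₀ (by positivity)]

theorem discMean_sub {ε : ℝ} {f g : ℂ → ℝ} {z : ℂ} {L : Set ℂ} (hL : Metric.closedBall z ε ⊆ L)
    (hf : IntegrableOn f L) (hg : IntegrableOn g L) :
    discMean ε (f - g) z = discMean ε f z - discMean ε g z := by
  simp only [discMean_eq, Pi.sub_apply]
  rw [integral_sub (hf.mono_set hL) (hg.mono_set hL), mul_sub]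

theorem discMean_midpoint {ε : ℝ} {f g : ℂ → ℝ} {z : ℂ} {L : Set ℂ}
    (hL : Metric.closedBall z ε ⊆ L) (hf : IntegrableOn f L) (hg : IntegrableOn g L) :
    discMean ε ((1 / 2 : ℝ) • (f + g)) z = (discMean ε f z + discMean ε g z) / 2 := by
  simp only [discMean_eq, Pi.smul_apply, Pi.add_apply, smul_eq_mul]
  rw [integral_const_mul, integral_add (hf.mono_set hL) (hg.mono_set hL)]
  ring

theorem abs_discMean_le {ε : ℝ} {f : ℂ → ℝ} {z : ℂ} {L : Set ℂ}
    (hL : Metric.closedBall z ε ⊆ L) (hf : IntegrableOn f L) :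
    |discMean ε f z| ≤ (Real.pi * ε ^ 2)⁻¹ * ∫ w in L, |f w| := by
  rw [discMean_eq, abs_mul, abs_of_nonneg (by positivity)]
  gcongr
  exact (abs_integral_le_integral_abs).trans (setIntegral_mono_set hf.abs
    (.of_forall fun _ ↦ abs_nonneg _) (LE.le.eventuallyLE hL))

theorem abs_discMean_sub_le {ε : ℝ} (hε : 0 < ε) {f : ℂ → ℝ} (hf : Continuous f) {z : ℂ} {η : ℝ}
    (h : ∀ w ∈ Metric.closedBall z ε, |f w - f z| ≤ η) : |discMean ε f z - f z| ≤ η := by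
  have hi : IntegrableOn f (Metric.closedBall z ε) :=
    hf.continuousOn.integrableOn_compact (isCompact_closedBall z ε)
  have h1 : discMean ε f z - f z =
      (Real.pi * ε ^ 2)⁻¹ * ∫ w in Metric.closedBall z ε, (f w - f z) := by
    have h2 := discMean_sub (ε := ε) (z := z) subset_rfl hi
      (g := fun _ ↦ f z) (integrableOn_const (isCompact_closedBall z ε).measure_ne_top)
    rw [discMean_const hε] at h2
    rw [← h2, discMean_eq]
    rfl
  have h3 := norm_setIntegral_le_of_norm_le_const (μ := volume) (s := Metric.closedBall z ε)
    (f := fun w ↦ f w - f z) (isCompact_closedBall z ε).measure_lt_top h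
  rw [volume_real_closedBall z hε.le, Real.norm_eq_abs] at h3
  rw [h1, abs_mul, abs_of_nonneg (by positivity), inv_mul_le_iff₀ (by positivity)]
  linarith

theorem integrable_discKernel_prod (ε : ℝ) {ν : Measure ℂ} [SFinite ν] {χ g : ℂ → ℝ}
    (hχ : Integrable χ ν) (hg : Integrable g) :
    Integrable (fun p : ℂ × ℂ ↦ χ p.1 * (discKernel ε p.1 p.2 * g p.2)) (ν.prod volume) := by
  have h := (hχ.mul_prod hg).bdd_mul (c := (Real.pi * ε ^ 2)⁻¹)
    (measurable_discKernel ε).aestronglyMeasurable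
    (.of_forall fun p ↦ by
      rw [Real.norm_of_nonneg (discKernel_nonneg ..)]; exact discKernel_le ..)
  refine h.congr (.of_forall fun p ↦ ?_)
  simp only
  ring

theorem integrable_mul_discMean (ε : ℝ) {ν : Measure ℂ} [SFinite ν] {χ g : ℂ → ℝ}
    (hχ : Integrable χ ν) (hg : Integrable g) : Integrable (fun z ↦ χ z * discMean ε g z) ν := by
  refine (integrable_discKernel_prod ε hχ hg).integral_prod_left.congr (.of_forall fun z ↦ ?_)
  simp only [discMean]
  rw [integral_const_mul]

theorem integral_mul_discMean_comm (ε : ℝ) {χ g : ℂ → ℝ} (hχ : Integrable χ) (hg : Integrable g) :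
    ∫ z, χ z * discMean ε g z = ∫ w, g w * discMean ε χ w := by
  have h1 : ∀ z, χ z * discMean ε g z = ∫ w, χ z * (discKernel ε z w * g w) := fun z ↦ by
    rw [integral_const_mul]; rfl
  have h2 : ∀ w, g w * discMean ε χ w = ∫ z, χ z * (discKernel ε z w * g w) := fun w ↦ by
    rw [discMean, ← integral_const_mul]
    refine integral_congr_ae (.of_forall fun z ↦ ?_)
    simp only [discKernel_comm ε w z]
    ring
  simp_rw [h1, h2]
  exact integral_integral_swap (integrable_discKernel_prod ε hχ hg)

theorem integrableOn_discMean {ε : ℝ} {f : ℂ → ℝ} {K L : Set ℂ} (hK : IsCompact K)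
    (hL : MeasurableSet L) (hKL : ∀ z ∈ K, Metric.closedBall z ε ⊆ L) (hf : IntegrableOn f L) :
    IntegrableOn (discMean ε f) K := by
  have : IsFiniteMeasure (volume.restrict K) := ⟨by simpa using hK.measure_lt_top⟩
  have h := integrable_mul_discMean ε (ν := volume.restrict K) (integrable_const (1 : ℝ))
    (hf.integrable_indicator hL)
  refine IntegrableOn.congr_fun (f := fun z ↦ 1 * discMean ε (L.indicator f) z) h
    (fun z hz ↦ ?_) hK.measurableSet
  simp only [one_mul]
  exact discMean_congr (hKL z hz) fun w hw ↦ Set.indicator_of_mem hw f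

theorem HasAreaSubmean.le_discMean {G : Set ℂ} {f : ℂ → ℝ} (hf : ContinuousOn f G)
    (hU : HasAreaSubmean G fun z ↦ (f z : EReal)) {z : ℂ} {ε : ℝ} (hε : 0 < ε)
    (hball : Metric.closedBall z ε ⊆ G) : f z ≤ discMean ε f z := by
  have hc := isCompact_closedBall z ε
  obtain ⟨b, hb⟩ := (hc.image_of_continuousOn (hf.mono hball)).bddAbove
  have hb' : ∀ w ∈ Metric.closedBall z ε, f w ≤ b := fun w hw ↦ hb (Set.mem_image_of_mem f hw)
  have hi : IntegrableOn f (Metric.closedBall z ε) := (hf.mono hball).integrableOn_compact hc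
  have hi' : IntegrableOn (fun w ↦ b - f w) (Metric.closedBall z ε) :=
    (integrableOn_const hc.measure_ne_top).sub hi
  have h := hU z ε b hε hball fun w hw ↦ EReal.coe_le_coe_iff.2 (hb' w hw)
  simp only [← EReal.coe_sub, EReal.real_coe_toENNReal] at h
  have hz := hb' z (Metric.mem_closedBall_self hε.le)
  rw [← ofReal_integral_eq_lintegral_ofReal hi'
    (ae_restrict_of_forall_mem measurableSet_closedBall fun w hw ↦ by simpa using hb' w hw),
    ← ofReal_measureReal hc.measure_ne_top, ← ENNReal.ofReal_mul (by linarith),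
    ENNReal.ofReal_le_ofReal_iff (mul_nonneg (by linarith) measureReal_nonneg),
    integral_sub (μ := volume.restrict (Metric.closedBall z ε)) (f := fun _ ↦ b)
      (integrableOn_const hc.measure_ne_top) hi, setIntegral_const, smul_eq_mul,
    volume_real_closedBall z hε.le] at h
  rw [discMean_eq, ← div_eq_inv_mul, le_div_iff₀ (by positivity)]
  linarith

/-- For functions with the sub-mean value property, averaging over small discs is close to the
identity in `L¹` on compact sets, uniformly on sets bounded in `L¹_loc`. -/
theorem exists_integral_abs_discMean_sub_le {G : Set ℂ} (hGo : IsOpen G) {K : Set ℂ}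
    (hK : IsCompact K) (hKG : K ⊆ G) :
    ∃ L, IsCompact L ∧ L ⊆ G ∧ ∀ η > 0, ∃ ε₀ > 0, ∀ ε, 0 < ε → ε ≤ ε₀ → ∀ f : ℂ → ℝ,
      ContinuousOn f G → HasAreaSubmean G (fun z ↦ (f z : EReal)) →
      ∫ z in K, |discMean ε f z - f z| ≤ η * ∫ z in L, |f z| := by
  obtain ⟨χ, hχ1, hχc, hχG, hχ0⟩ :=
    exists_continuousMap_one_of_isCompact_subset_isOpen hK hGo hKG
  obtain ⟨δ, hδ, hδG⟩ := hχc.exists_cthickening_subset_open hGo hχG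
  set L := Metric.cthickening δ (tsupport χ) with hL
  have hLc : IsCompact L := hχc.cthickening
  refine ⟨L, hLc, hδG, fun η hη ↦ ?_⟩
  have hχu : UniformContinuous χ :=
    HasCompactSupport.uniformContinuous_of_continuous hχc χ.continuous
  obtain ⟨ε₁, hε₁, hχε⟩ := Metric.uniformContinuous_iff.1 hχu η hη
  refine ⟨min δ (ε₁ / 2), lt_min hδ (by positivity), fun ε hε hε₀ f hf hU ↦ ?_⟩
  have hεδ : ε ≤ δ := hε₀.trans (min_le_left _ _)
  have hεε₁ : ε < ε₁ := by linarith [hε₀.trans (min_le_right _ _)]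
  have hball : ∀ z ∈ tsupport χ, Metric.closedBall z ε ⊆ L := fun z hz ↦
    (Metric.closedBall_subset_cthickening hz ε).trans (Metric.cthickening_mono hεδ _)
  have hsub : tsupport χ ⊆ L := fun z hz ↦ hball z hz (Metric.mem_closedBall_self hε.le)
  have hKχ : K ⊆ tsupport χ := fun z hz ↦ subset_tsupport _ (by simp [hχ1 hz])
  have hfL : IntegrableOn f L := (hf.mono hδG).integrableOn_compact hLc
  set g := L.indicator f with hg
  have hgi : Integrable g := hfL.integrable_indicator hLc.measurableSet
  have hgf : Set.EqOn g f L := fun z hz ↦ Set.indicator_of_mem hz f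
  have hχi : Integrable χ := χ.continuous.integrable_of_hasCompactSupport hχc
  have hint1 := integrable_mul_discMean ε hχi hgi
  have hint2 : Integrable fun z ↦ χ z * g z :=
    hgi.bdd_mul (c := 1) χ.continuous.aestronglyMeasurable
      (.of_forall fun z ↦ by rw [Real.norm_of_nonneg (hχ0 z).1]; exact (hχ0 z).2)
  have hint3 : Integrable fun z ↦ g z * discMean ε χ z := by
    refine hgi.mul_bdd (c := 1 + η) ?_ (.of_forall fun z ↦ ?_)
    · exact (Measurable.stronglyMeasurable (by
        have := (measurable_discKernel ε).mul (χ.continuous.measurable.comp measurable_snd)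
        exact this.stronglyMeasurable.integral_prod_right.measurable)).aestronglyMeasurable
    · have h1 := abs_discMean_sub_le hε χ.continuous (z := z) (η := η) fun w hw ↦
        (hχε ((Metric.mem_closedBall.1 hw).trans_lt hεε₁)).le
      have h2 := hχ0 z
      rw [abs_le] at h1
      rw [Real.norm_eq_abs, abs_le]
      constructor <;> linarith [h1.1, h1.2, h2.1, h2.2]
  have hnonneg : ∀ z, 0 ≤ χ z * discMean ε g z - χ z * g z := fun z ↦ by
    rw [← mul_sub]
    by_cases hz : z ∈ tsupport χ
    · refine mul_nonneg (hχ0 z).1 (sub_nonneg.2 ?_)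
      rw [discMean_congr (hball z hz) hgf, hgf (hsub hz)]
      exact hU.le_discMean hf hε ((hball z hz).trans hδG)
    · simp [image_eq_zero_of_notMem_tsupport hz]
  have hKeq : Set.EqOn (fun z ↦ |discMean ε f z - f z|)
      (fun z ↦ χ z * discMean ε g z - χ z * g z) K := fun z hz ↦ by
    have hz' := hKχ hz
    have h1 := hU.le_discMean hf hε ((hball z hz').trans hδG)
    simp only
    rw [discMean_congr (hball z hz') hgf, hgf (hsub hz'), hχ1 hz, Pi.one_apply, one_mul, one_mul,
      abs_of_nonneg (sub_nonneg.2 h1)]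
  calc ∫ z in K, |discMean ε f z - f z|
      = ∫ z in K, (χ z * discMean ε g z - χ z * g z) :=
        setIntegral_congr_fun hK.measurableSet hKeq
    _ ≤ ∫ z, (χ z * discMean ε g z - χ z * g z) :=
        setIntegral_le_integral (hint1.sub hint2) (.of_forall hnonneg)
    _ = ∫ z, (g z * discMean ε χ z - χ z * g z) := by
        rw [integral_sub hint1 hint2, integral_mul_discMean_comm ε hχi hgi,
          integral_sub hint3 hint2]
    _ ≤ ∫ z, η * |g z| := by
        refine integral_mono (hint3.sub hint2) (hgi.abs.const_mul η) fun z ↦ ?_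
        have h1 := abs_discMean_sub_le hε χ.continuous (z := z) (η := η) fun w hw ↦
          (hχε ((Metric.mem_closedBall.1 hw).trans_lt hεε₁)).le
        calc g z * discMean ε χ z - χ z * g z = g z * (discMean ε χ z - χ z) := by ring
          _ ≤ |g z| * |discMean ε χ z - χ z| := (le_abs_self _).trans (abs_mul _ _).le
          _ ≤ η * |g z| := by rw [mul_comm]; gcongr
    _ = η * ∫ z in L, |f z| := by
        rw [integral_const_mul, ← integral_indicator hLc.measurableSet]
        congr 2
        ext z
        by_cases hz : z ∈ L <;> simp [hg, hz]

/-- Almost minimizers of countably many quadratic functionals over a decreasing sequence of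
midpoint-convex sets form a Cauchy sequence for each of them. -/
theorem exists_seq_cauchy_of_parallelogram {V : Type*} [AddCommGroup V] [Module ℝ V]
    {D : ℕ → Set V} (hanti : Antitone D)
    (hmid : ∀ n, ∀ a ∈ D n, ∀ b ∈ D n, (1 / 2 : ℝ) • (a + b) ∈ D n) (hne : ∀ n, (D n).Nonempty)
    {q : ℕ → V → ℝ} (hq : ∀ k v, 0 ≤ q k v)
    (hpar : ∀ k, ∀ a ∈ D 0, ∀ b ∈ D 0,
      q k ((1 / 2 : ℝ) • (a + b)) + q k (a - b) / 4 = (q k a + q k b) / 2)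
    (hbdd : ∀ k, ∃ B, ∀ a ∈ D 0, q k a ≤ B) :
    ∃ f : ℕ → V, (∀ n, f n ∈ D n) ∧
      ∀ k, ∀ ε > 0, ∃ N, ∀ n ≥ N, ∀ m ≥ N, q k (f n - f m) < ε := by
  choose B hB using hbdd
  have hD0 : ∀ n, D n ⊆ D 0 := fun n ↦ hanti (Nat.zero_le n)
  set c : ℕ → ℝ := fun k ↦ (1 / 2) ^ k / (1 + |B k|) with hc
  have hc0 : ∀ k, 0 < c k := fun k ↦ by positivity
  have hcq : ∀ a ∈ D 0, ∀ k, c k * q k a ≤ (1 / 2) ^ k := fun a ha k ↦ by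
    simp only [hc]
    rw [div_mul_eq_mul_div, div_le_iff₀ (by positivity)]
    gcongr
    linarith [hB k a ha, le_abs_self (B k)]
  have hsum : ∀ a ∈ D 0, Summable fun k ↦ c k * q k a := fun a ha ↦
    Summable.of_nonneg_of_le (fun k ↦ mul_nonneg (hc0 k).le (hq k a)) (hcq a ha)
      summable_geometric_two
  set Q : V → ℝ := fun a ↦ ∑' k, c k * q k a with hQ
  have hQ0 : ∀ a, 0 ≤ Q a := fun a ↦ tsum_nonneg fun k ↦ mul_nonneg (hc0 k).le (hq k a)
  have hQ2 : ∀ a ∈ D 0, Q a ≤ 2 := fun a ha ↦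
    ((hsum a ha).tsum_le_tsum (hcq a ha) summable_geometric_two).trans_eq tsum_geometric_two
  have hkey : ∀ a ∈ D 0, ∀ b ∈ D 0, ∀ k,
      c k * q k (a - b) ≤ 2 * (Q a + Q b) - 4 * Q ((1 / 2 : ℝ) • (a + b)) := by
    intro a ha b hb k
    have hm := hmid 0 a ha b hb
    have h1 : HasSum (fun k ↦ c k * q k (a - b))
        (2 * (Q a + Q b) - 4 * Q ((1 / 2 : ℝ) • (a + b))) := by
      refine ((((hsum a ha).hasSum.add (hsum b hb).hasSum).mul_left 2).sub
        ((hsum _ hm).hasSum.mul_left 4)).congr_fun fun k ↦ ?_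
      linear_combination 4 * c k * hpar k a ha b hb
    rw [← h1.tsum_eq]
    exact h1.summable.le_tsum k fun j _ ↦ mul_nonneg (hc0 j).le (hq j _)
  set I : ℕ → ℝ := fun n ↦ sInf (Q '' D n) with hI
  have hbelow : ∀ n, BddBelow (Q '' D n) := fun n ↦ ⟨0, by rintro _ ⟨a, _, rfl⟩; exact hQ0 a⟩
  have hImono : Monotone I := fun n m hnm ↦
    csInf_le_csInf (hbelow n) ((hne m).image Q) (Set.image_mono (hanti hnm))
  have hI2 : ∀ n, I n ≤ 2 := fun n ↦ by
    obtain ⟨a, ha⟩ := hne n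
    exact (csInf_le (hbelow n) (Set.mem_image_of_mem Q ha)).trans (hQ2 a (hD0 n ha))
  have hIlim := tendsto_atTop_ciSup hImono ⟨2, by rintro _ ⟨n, rfl⟩; exact hI2 n⟩
  set J := ⨆ n, I n
  have hIJ : ∀ n, I n ≤ J := fun n ↦ hImono.ge_of_tendsto hIlim n
  have hex : ∀ n : ℕ, ∃ a ∈ D n, Q a < I n + 1 / ((n : ℝ) + 1) := fun n ↦ by
    obtain ⟨_, ⟨a, ha, rfl⟩, h⟩ := exists_lt_of_csInf_lt ((hne n).image Q)
      (lt_add_of_pos_right (I n) (by positivity : (0 : ℝ) < 1 / ((n : ℝ) + 1)))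
    exact ⟨a, ha, h⟩
  choose f hfD hfQ using hex
  refine ⟨f, hfD, fun k ε hε ↦ ?_⟩
  have hlim : Tendsto (fun N : ℕ ↦ 4 * (J + 1 / ((N : ℝ) + 1) - I N)) atTop (𝓝 0) := by
    have := ((tendsto_const_nhds (x := J)).add
      (tendsto_one_div_add_atTop_nhds_zero_nat (𝕜 := ℝ))).sub hIlim
    simpa using this.const_mul 4
  obtain ⟨N, hN⟩ := (hlim.eventually (gt_mem_nhds (mul_pos (hc0 k) hε))).exists
  refine ⟨N, fun n hn m hm ↦ ?_⟩
  have h1 := hkey (f n) (hD0 n (hfD n)) (f m) (hD0 m (hfD m)) k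
  have h2 : I N ≤ Q ((1 / 2 : ℝ) • (f n + f m)) := csInf_le (hbelow N)
    (Set.mem_image_of_mem Q (hmid N _ (hanti hn (hfD n)) _ (hanti hm (hfD m))))
  have h3 : ∀ l ≥ N, Q (f l) ≤ J + 1 / ((N : ℝ) + 1) := fun l hl ↦ by
    refine (hfQ l).le.trans (add_le_add (hIJ l) ?_)
    gcongr
  have h4 := h3 n hn
  have h5 := h3 m hm
  exact lt_of_mul_lt_mul_left (by linarith) (hc0 k).le

theorem isCompact_preimage_subtypeVal {G K : Set ℂ} (hK : IsCompact K) (hKG : K ⊆ G) :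
    IsCompact (Subtype.val ⁻¹' K : Set G) := by
  rw [Subtype.isCompact_iff, Subtype.image_preimage_coe, Set.inter_eq_right.2 hKG]
  exact hK

theorem exists_compact_exhaustion {G : Set ℂ} (hGo : IsOpen G) :
    ∃ K : ℕ → Set ℂ, Monotone K ∧ (∀ n, IsCompact (K n)) ∧ (∀ n, K n ⊆ G) ∧
      ∀ S ⊆ G, IsCompact S → ∃ n, S ⊆ K n := by
  have := hGo.locallyCompactSpace
  have X := CompactExhaustion.choice G
  refine ⟨fun n ↦ Subtype.val '' X n, fun n m hnm ↦ Set.image_mono (X.subset hnm),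
    fun n ↦ (X.isCompact n).image continuous_subtype_val, fun n ↦ by simp, fun S hS hSc ↦ ?_⟩
  obtain ⟨n, hn⟩ := X.exists_superset_of_isCompact (isCompact_preimage_subtypeVal hSc hS)
  exact ⟨n, fun z hz ↦ ⟨⟨z, hS hz⟩, hn hz, rfl⟩⟩

theorem integral_sq_discMean_parallelogram {ε : ℝ} {f g : ℂ → ℝ} {K L : Set ℂ} (hK : IsCompact K)
    (hL : MeasurableSet L) (hKL : ∀ z ∈ K, Metric.closedBall z ε ⊆ L) (hf : IntegrableOn f L)
    (hg : IntegrableOn g L) :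
    (∫ z in K, discMean ε ((1 / 2 : ℝ) • (f + g)) z ^ 2)
        + (∫ z in K, discMean ε (f - g) z ^ 2) / 4
      = ((∫ z in K, discMean ε f z ^ 2) + ∫ z in K, discMean ε g z ^ 2) / 2 := by
  have hsq : ∀ {k : ℂ → ℝ}, IntegrableOn k L → IntegrableOn (fun z ↦ discMean ε k z ^ 2) K := by
    intro k hk
    simp_rw [pow_two]
    refine Integrable.bdd_mul (c := (Real.pi * ε ^ 2)⁻¹ * ∫ w in L, |k w|)
      (integrableOn_discMean hK hL hKL hk)
      (integrableOn_discMean hK hL hKL hk).aestronglyMeasurable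
      (ae_restrict_of_forall_mem hK.measurableSet fun z hz ↦ abs_discMean_le (hKL z hz) hk)
  rw [← integral_add (hsq hf) (hsq hg), ← integral_div, ← integral_div,
    ← integral_add (hsq ((hf.add hg).smul _)) ((hsq (hf.sub hg)).div_const 4)]
  refine setIntegral_congr_fun hK.measurableSet fun z hz ↦ ?_
  rw [discMean_midpoint (hKL z hz) hf hg, discMean_sub (hKL z hz) hf hg]
  ring

theorem integral_abs_le_of_sq {K : Set ℂ} (hK : IsCompact K) {a : ℂ → ℝ} (ha : IntegrableOn a K)
    (ha2 : IntegrableOn (fun z ↦ a z ^ 2) K) {η : ℝ} (hη : 0 < η) :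
    ∫ z in K, |a z| ≤ η * volume.real K + η⁻¹ * ∫ z in K, a z ^ 2 := by
  have h1 : ∫ z in K, (η + η⁻¹ * a z ^ 2) = η * volume.real K + η⁻¹ * ∫ z in K, a z ^ 2 := by
    rw [integral_add (μ := volume.restrict K) (f := fun _ ↦ η)
      (integrableOn_const hK.measure_ne_top) (ha2.const_mul _), setIntegral_const,
      integral_const_mul, smul_eq_mul, mul_comm]
  rw [← h1]
  refine setIntegral_mono ha.abs
    ((integrableOn_const hK.measure_ne_top).add (ha2.const_mul _)) fun z ↦ ?_
  have h2 : η * |a z| ≤ η ^ 2 + a z ^ 2 := by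
    rw [← sq_abs (a z)]
    nlinarith [sq_nonneg (η - |a z|), sq_nonneg η, sq_nonneg (a z), abs_nonneg (a z), sq_abs (a z)]
  have h3 : |a z| = η⁻¹ * (η * |a z|) := by field_simp
  have h4 : η + η⁻¹ * a z ^ 2 = η⁻¹ * (η ^ 2 + a z ^ 2) := by field_simp
  simp only
  rw [h3, h4]
  gcongr

/-- A sequence of continuous functions with the sub-mean value property that is bounded in
`L¹_loc` has convex combinations of its tails that form a Cauchy sequence in `L¹_loc`. -/
theorem exists_convexHull_seq_cauchy {G : Set ℂ} (hGo : IsOpen G) {𝓒 : Set (ℂ → ℝ)}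
    (h𝓒 : Convex ℝ 𝓒) (hcont : ∀ f ∈ 𝓒, ContinuousOn f G)
    (hsub : ∀ f ∈ 𝓒, HasAreaSubmean G fun z ↦ (f z : EReal)) {h : ℕ → ℂ → ℝ} (hh : ∀ n, h n ∈ 𝓒)
    (hbdd : ∀ K ⊆ G, IsCompact K → ∃ C : ℝ, ∀ n, ∫ z in K, |h n z| ≤ C) :
    ∃ f : ℕ → ℂ → ℝ, (∀ n, f n ∈ convexHull ℝ (h '' Set.Ici n)) ∧
      ∀ K ⊆ G, IsCompact K → ∀ η > 0, ∃ N, ∀ n ≥ N, ∀ m ≥ N, ∫ z in K, |f n z - f m z| ≤ η := by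
  obtain ⟨K, hKmono, hKc, hKG, hKex⟩ := exists_compact_exhaustion hGo
  have hint : ∀ f ∈ 𝓒, ∀ S ⊆ G, IsCompact S → IntegrableOn f S := fun f hf S hS hSc ↦
    ((hcont f hf).mono hS).integrableOn_compact hSc
  have hδ : ∀ k : ℕ, ∃ ε > 0, ε ≤ 1 / ((k : ℝ) + 1) ∧ Metric.cthickening ε (K k) ⊆ G := fun k ↦ by
    obtain ⟨δ, hδ, hδG⟩ := (hKc k).exists_cthickening_subset_open hGo (hKG k)
    exact ⟨min δ (1 / ((k : ℝ) + 1)), lt_min hδ (by positivity), min_le_right _ _,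
      (Metric.cthickening_mono (min_le_left _ _) _).trans hδG⟩
  choose ε hε0 hεk hεG using hδ
  set L : ℕ → Set ℂ := fun k ↦ Metric.cthickening (ε k) (K k) with hL
  have hLc : ∀ k, IsCompact (L k) := fun k ↦ (hKc k).cthickening
  have hKL : ∀ k, ∀ z ∈ K k, Metric.closedBall z (ε k) ⊆ L k := fun k z hz ↦
    Metric.closedBall_subset_cthickening hz _
  set D : ℕ → Set (ℂ → ℝ) := fun n ↦ convexHull ℝ (h '' Set.Ici n) with hD
  have hD𝓒 : ∀ n, D n ⊆ 𝓒 := fun n ↦ convexHull_min (by rintro _ ⟨m, _, rfl⟩; exact hh m) h𝓒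
  have hDbdd : ∀ S ⊆ G, IsCompact S → ∃ C : ℝ, 0 ≤ C ∧ ∀ n, ∀ f ∈ D n, ∫ z in S, |f z| ≤ C := by
    intro S hS hSc
    obtain ⟨C, hC⟩ := hbdd S hS hSc
    have hconv : Convex ℝ {f : ℂ → ℝ | f ∈ 𝓒 ∧ ∫ z in S, |f z| ≤ C} := by
      intro f hf g hg a b ha hb hab
      refine ⟨h𝓒 hf.1 hg.1 ha hb hab, ?_⟩
      have hfi := (hint f hf.1 S hS hSc).abs
      have hgi := (hint g hg.1 S hS hSc).abs
      calc ∫ z in S, |(a • f + b • g) z| ≤ ∫ z in S, (a * |f z| + b * |g z|) := by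
            refine integral_mono (hint _ (h𝓒 hf.1 hg.1 ha hb hab) S hS hSc).abs
              ((hfi.const_mul a).add (hgi.const_mul b)) fun z ↦ ?_
            refine (abs_add_le _ _).trans_eq ?_
            simp [abs_mul, abs_of_nonneg ha, abs_of_nonneg hb]
        _ = a * (∫ z in S, |f z|) + b * ∫ z in S, |g z| := by
            rw [integral_add (hfi.const_mul a) (hgi.const_mul b), integral_const_mul,
              integral_const_mul]
        _ ≤ a * C + b * C := by gcongr; exacts [hf.2, hg.2]
        _ = C := by rw [← add_mul, hab, one_mul]
    refine ⟨C, (integral_nonneg fun z ↦ abs_nonneg _).trans (hC 0), fun n f hf ↦ ?_⟩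
    exact (convexHull_min (by rintro _ ⟨m, _, rfl⟩; exact ⟨hh m, hC m⟩) hconv hf).2
  have hintL : ∀ f ∈ 𝓒, ∀ k, IntegrableOn f (L k) := fun f hf k ↦ hint f hf _ (hεG k) (hLc k)
  obtain ⟨f, hfD, hfq⟩ := exists_seq_cauchy_of_parallelogram (D := D)
    (q := fun k f ↦ ∫ z in K k, discMean (ε k) f z ^ 2)
    (fun n m hnm ↦ convexHull_mono (Set.image_mono (Set.Ici_subset_Ici.2 hnm)))
    (fun n a ha b hb ↦ by
      rw [smul_add]
      exact convex_convexHull ℝ _ ha hb (by norm_num) (by norm_num) (by norm_num))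
    (fun n ↦ ⟨h n, subset_convexHull ℝ _ ⟨n, Set.self_mem_Ici, rfl⟩⟩)
    (fun k f ↦ integral_nonneg fun z ↦ sq_nonneg _)
    (fun k a ha b hb ↦ integral_sq_discMean_parallelogram (hKc k) (hLc k).measurableSet (hKL k)
      (hintL a (hD𝓒 0 ha) k) (hintL b (hD𝓒 0 hb) k))
    (fun k ↦ by
      obtain ⟨C, hC0, hC⟩ := hDbdd (L k) (hεG k) (hLc k)
      refine ⟨((Real.pi * ε k ^ 2)⁻¹ * C) ^ 2 * volume.real (K k), fun a ha ↦ ?_⟩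
      refine (Real.le_norm_self _).trans (norm_setIntegral_le_of_norm_le_const
        (hKc k).measure_lt_top fun z hz ↦ ?_)
      rw [Real.norm_of_nonneg (sq_nonneg _), ← sq_abs]
      gcongr
      refine (abs_discMean_le (hKL k z hz) (hintL a (hD𝓒 0 ha) k)).trans ?_
      gcongr
      exact hC 0 a ha)
  refine ⟨f, hfD, fun S hS hSc η hη ↦ ?_⟩
  have hf𝓒 : ∀ n, f n ∈ 𝓒 := fun n ↦ hD𝓒 n (hfD n)
  obtain ⟨T, hTc, hTG, hT⟩ := exists_integral_abs_discMean_sub_le hGo hSc hS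
  obtain ⟨C, hC0, hC⟩ := hDbdd T hTG hTc
  obtain ⟨ε₀, hε₀, hmean⟩ := hT (η / (4 * (C + 1))) (by positivity)
  obtain ⟨k₁, hk₁⟩ := hKex S hS hSc
  obtain ⟨k₂, hk₂⟩ := exists_nat_one_div_lt hε₀
  set k := max k₁ k₂
  have hSk : S ⊆ K k := hk₁.trans (hKmono (le_max_left _ _))
  have hεk₀ : ε k ≤ ε₀ := by
    refine (hεk k).trans (le_trans ?_ hk₂.le)
    have : (k₂ : ℝ) ≤ k := by exact_mod_cast le_max_right k₁ k₂
    gcongr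
  set V := volume.real (K k)
  have hV : 0 ≤ V := measureReal_nonneg
  set ζ := η / (4 * (V + 1)) with hζ
  have hζ0 : 0 < ζ := by positivity
  obtain ⟨N, hN⟩ := hfq k (ζ * (η / 4)) (by positivity)
  refine ⟨N, fun n hn m hm ↦ ?_⟩
  have hmeanle : ∀ j, ∫ z in S, |discMean (ε k) (f j) z - f j z| ≤ η / 4 := fun j ↦ by
    refine (hmean (ε k) (hε0 k) hεk₀ (f j) (hcont _ (hf𝓒 j)) (hsub _ (hf𝓒 j))).trans ?_
    calc η / (4 * (C + 1)) * ∫ z in T, |f j z| ≤ η / (4 * (C + 1)) * (C + 1) := by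
          gcongr; linarith [hC j _ (hfD j)]
      _ = η / 4 := by field_simp
  have hKLS : ∀ z ∈ S, Metric.closedBall z (ε k) ⊆ L k := fun z hz ↦ hKL k z (hSk hz)
  have hAi : ∀ j, IntegrableOn (discMean (ε k) (f j)) S := fun j ↦
    integrableOn_discMean hSc (hLc k).measurableSet hKLS (hintL _ (hf𝓒 j) k)
  have hfi : ∀ j, IntegrableOn (f j) S := fun j ↦ hint _ (hf𝓒 j) S hS hSc
  have hdL := (hintL _ (hf𝓒 n) k).sub (hintL _ (hf𝓒 m) k)
  have hdK := integrableOn_discMean (hKc k) (hLc k).measurableSet (hKL k) hdL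
  have hdK2 : IntegrableOn (fun z ↦ discMean (ε k) (f n - f m) z ^ 2) (K k) := by
    simp_rw [pow_two]
    exact hdK.bdd_mul hdK.aestronglyMeasurable
      (ae_restrict_of_forall_mem (hKc k).measurableSet fun z hz ↦ abs_discMean_le (hKL k z hz) hdL)
  have hdle : ∫ z in S, |discMean (ε k) (f n - f m) z| ≤ η / 2 := by
    refine (setIntegral_mono_set hdK.abs (.of_forall fun _ ↦ abs_nonneg _)
      (LE.le.eventuallyLE hSk)).trans ((integral_abs_le_of_sq (hKc k) hdK hdK2 hζ0).trans ?_)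
    have h1 : ζ * V ≤ η / 4 := by
      rw [hζ, div_mul_eq_mul_div, div_le_iff₀ (by positivity)]
      nlinarith
    have h2 : ζ⁻¹ * ∫ z in K k, discMean (ε k) (f n - f m) z ^ 2 ≤ η / 4 := by
      rw [inv_mul_le_iff₀ hζ0]
      exact (hN n hn m hm).le
    linarith
  calc ∫ z in S, |f n z - f m z|
      ≤ ∫ z in S, (|discMean (ε k) (f n) z - f n z| + |discMean (ε k) (f m) z - f m z|
          + |discMean (ε k) (f n - f m) z|) := by
        refine setIntegral_mono_on ((hfi n).sub (hfi m)).abs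
          ((((hAi n).sub (hfi n)).abs.add ((hAi m).sub (hfi m)).abs).add
            (hdK.mono_set hSk).abs) hSc.measurableSet fun z hz ↦ ?_
        rw [discMean_sub (hKLS z hz) (hintL _ (hf𝓒 n) k) (hintL _ (hf𝓒 m) k)]
        have h1 : f n z - f m z = -(discMean (ε k) (f n) z - f n z)
          + (discMean (ε k) (f m) z - f m z)
          + (discMean (ε k) (f n) z - discMean (ε k) (f m) z) := by ring
        rw [h1]
        refine (abs_add_le _ _).trans (add_le_add_left ((abs_add_le _ _).trans ?_) _)
        rw [abs_neg]
    _ = (∫ z in S, |discMean (ε k) (f n) z - f n z|)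
        + (∫ z in S, |discMean (ε k) (f m) z - f m z|)
        + ∫ z in S, |discMean (ε k) (f n - f m) z| := by
        have h1 : ∀ j, Integrable (fun z ↦ |discMean (ε k) (f j) z - f j z|)
            (volume.restrict S) := fun j ↦ ((hAi j).sub (hfi j)).abs
        have h2 : Integrable (fun z ↦ |discMean (ε k) (f n) z - f n z|
            + |discMean (ε k) (f m) z - f m z|) (volume.restrict S) := (h1 n).add (h1 m)
        rw [integral_add h2 (hdK.mono_set hSk).abs, integral_add (h1 n) (h1 m)]
    _ ≤ η := by linarith [hmeanle n, hmeanle m]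

theorem exists_integrable_tendsto_of_cauchy {α : Type*} [MeasurableSpace α] {ν : Measure α}
    {f : ℕ → α → ℝ} (hf : ∀ n, Integrable (f n) ν)
    (hcau : ∀ η > 0, ∃ N, ∀ n ≥ N, ∀ m ≥ N, ∫ z, |f n z - f m z| ∂ν ≤ η) :
    ∃ w : α → ℝ, Integrable w ν ∧
      Tendsto (fun n ↦ ∫⁻ z, ENNReal.ofReal |f n z - w z| ∂ν) atTop (𝓝 0) := by
  have hcau' : CauchySeq fun n ↦ (hf n).toL1 (f n) := by
    refine Metric.cauchySeq_iff.2 fun η hη ↦ ?_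
    obtain ⟨N, hN⟩ := hcau (η / 2) (by positivity)
    refine ⟨N, fun n hn m hm ↦ ?_⟩
    rw [dist_edist, Integrable.edist_toL1_toL1]
    simp_rw [edist_dist, Real.dist_eq]
    have hi : Integrable (fun z ↦ |f n z - f m z|) ν := ((hf n).sub (hf m)).abs
    rw [← ofReal_integral_eq_lintegral_ofReal hi (.of_forall fun z ↦ abs_nonneg _),
      ENNReal.toReal_ofReal (integral_nonneg fun z ↦ abs_nonneg _)]
    linarith [hN n hn m hm]
  obtain ⟨W, hW⟩ := cauchySeq_tendsto_of_complete hcau'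
  refine ⟨W, L1.integrable_coeFn W, ?_⟩
  have h1 := tendsto_iff_edist_tendsto_0.1 hW
  refine h1.congr fun n ↦ ?_
  conv_lhs => rw [← Integrable.toL1_coeFn W (L1.integrable_coeFn W)]
  rw [Integrable.edist_toL1_toL1]
  simp_rw [edist_dist, Real.dist_eq]

theorem ae_eq_of_tendsto_lintegral {α : Type*} [MeasurableSpace α] {ν : Measure α}
    {f : ℕ → α → ℝ} {w w' : α → ℝ} (hf : ∀ n, AEMeasurable (f n) ν) (hw : AEMeasurable w ν)
    (hw' : AEMeasurable w' ν)
    (h : Tendsto (fun n ↦ ∫⁻ z, ENNReal.ofReal |f n z - w z| ∂ν) atTop (𝓝 0))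
    (h' : Tendsto (fun n ↦ ∫⁻ z, ENNReal.ofReal |f n z - w' z| ∂ν) atTop (𝓝 0)) : w =ᵐ[ν] w' := by
  have h0 : ∫⁻ z, ENNReal.ofReal |w z - w' z| ∂ν = 0 := by
    refine le_antisymm (ge_of_tendsto (by simpa using h.add h') (.of_forall fun n ↦ ?_)) bot_le
    rw [← lintegral_add_left' (by fun_prop)]
    refine lintegral_mono fun z ↦ ?_
    rw [← ENNReal.ofReal_add (abs_nonneg _) (abs_nonneg _), abs_sub_comm (f n z) (w z)]
    exact ENNReal.ofReal_le_ofReal (abs_sub_le _ _ _)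
  rw [lintegral_eq_zero_iff' (by fun_prop)] at h0
  filter_upwards [h0] with z hz
  have : |w z - w' z| ≤ 0 := by simpa using hz
  exact sub_eq_zero.1 (abs_nonpos_iff.1 this)

/-- A Cauchy sequence in `L¹_loc(G)` converges. -/
theorem exists_tendsto_of_cauchy_on_compacts {G : Set ℂ} (hGo : IsOpen G) {f : ℕ → ℂ → ℝ}
    (hf : ∀ n, ContinuousOn (f n) G)
    (hcau : ∀ K ⊆ G, IsCompact K → ∀ η > 0, ∃ N, ∀ n ≥ N, ∀ m ≥ N,
      ∫ z in K, |f n z - f m z| ≤ η) :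
    ∃ w : ℂ → ℝ, ∀ K ⊆ G, IsCompact K → IntegrableOn w K ∧
      Tendsto (fun n ↦ ∫⁻ z in K, ENNReal.ofReal |f n z - w z|) atTop (𝓝 0) := by
  classical
  obtain ⟨K, hKmono, hKc, hKG, hKex⟩ := exists_compact_exhaustion hGo
  have hfi : ∀ n k, IntegrableOn (f n) (K k) := fun n k ↦
    ((hf n).mono (hKG k)).integrableOn_compact (hKc k)
  choose w hwi hw using fun k ↦
    exists_integrable_tendsto_of_cauchy (fun n ↦ hfi n k) (hcau (K k) (hKG k) (hKc k))
  have hmono : ∀ {S : Set ℂ} {k : ℕ} {w : ℂ → ℝ}, S ⊆ K k →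
      Tendsto (fun n ↦ ∫⁻ z in K k, ENNReal.ofReal |f n z - w z|) atTop (𝓝 0) →
      Tendsto (fun n ↦ ∫⁻ z in S, ENNReal.ofReal |f n z - w z|) atTop (𝓝 0) := fun hS h ↦
    tendsto_of_tendsto_of_tendsto_of_le_of_le tendsto_const_nhds h (fun _ ↦ bot_le)
      fun n ↦ lintegral_mono_set hS
  have hcompat : ∀ i k, i ≤ k → ∀ᵐ z, z ∈ K i → w i z = w k z := fun i k hik ↦ by
    rw [← ae_restrict_iff' (hKc i).measurableSet]
    exact ae_eq_of_tendsto_lintegral (fun n ↦ (hfi n i).aestronglyMeasurable.aemeasurable)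
      (hwi i).aestronglyMeasurable.aemeasurable
      ((hwi k).mono_measure
        (Measure.restrict_mono_set _ (hKmono hik))).aestronglyMeasurable.aemeasurable
      (hw i) (hmono (hKmono hik) (hw k))
  set W : ℂ → ℝ := fun z ↦ if h : ∃ k, z ∈ K k then w (Nat.find h) z else 0 with hW
  have hWw : ∀ k, W =ᵐ[volume.restrict (K k)] w k := fun k ↦ by
    rw [EventuallyEq, ae_restrict_iff' (hKc k).measurableSet]
    have : ∀ᵐ z, ∀ i k, i ≤ k → z ∈ K i → w i z = w k z := by
      simpa only [ae_all_iff] using hcompat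
    filter_upwards [this] with z hz hzk
    have h : ∃ k, z ∈ K k := ⟨k, hzk⟩
    simp only [hW, dif_pos h]
    exact hz _ k (Nat.find_min' h hzk) (Nat.find_spec h)
  refine ⟨W, fun S hS hSc ↦ ?_⟩
  obtain ⟨k, hk⟩ := hKex S hS hSc
  refine ⟨IntegrableOn.mono_set ((integrable_congr (hWw k)).2 (hwi k)) hk, hmono hk ?_⟩
  refine (hw k).congr fun n ↦ lintegral_congr_ae ?_
  filter_upwards [hWw k] with z hz
  rw [hz]

section Duality

variable {G : Set ℂ} {H : Set (G → EReal)}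

theorem integrableOn_comp_subtypeVal_iff (hG : MeasurableSet G) {w : ℂ → ℝ} {K : Set G} :
    IntegrableOn (fun z : G ↦ w z) K (areaMeasure G) ↔ IntegrableOn w (Subtype.val '' K) := by
  have he := MeasurableEmbedding.subtype_coe hG
  rw [IntegrableOn, areaMeasure, he.restrict_comap]
  change Integrable (w ∘ Subtype.val) _ ↔ _
  rw [← he.integrable_map_iff, he.map_comap, Subtype.range_coe, Measure.restrict_restrict hG,
    Set.inter_eq_right.2 (Subtype.coe_image_subset _ _), IntegrableOn]

theorem ae_areaMeasure_iff (hG : MeasurableSet G) {p : ℂ → Prop} :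
    (∀ᵐ z : G ∂areaMeasure G, p z) ↔ ∀ᵐ z, z ∈ G → p z := by
  have he := MeasurableEmbedding.subtype_coe hG
  rw [areaMeasure, ← he.ae_map_iff, he.map_comap, Subtype.range_coe, ae_restrict_iff' hG]

theorem exists_measurable_extension {Y : Type*} [MeasurableSpace Y] [Nonempty Y]
    (hG : MeasurableSet G) {f : G → Y} (hf : Measurable f) :
    ∃ F : ℂ → Y, Measurable F ∧ ∀ z : G, F z = f z :=
  ⟨Function.extend Subtype.val f fun _ ↦ Classical.arbitrary Y,
    (MeasurableEmbedding.subtype_coe hG).measurable_extend hf measurable_const,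
    fun z ↦ Subtype.val_injective.extend_apply _ _ z⟩

/-- Measurable functions on the plane whose restriction to `G` is a continuous element of `H`. -/
def planarContinuousPart (H : Set (G → EReal)) : Set (ℂ → ℝ) :=
  {f | Measurable f ∧ (fun z : G ↦ f z) ∈ continuousPart H}

theorem IsConeOfSubharmonic.convex_planarContinuousPart (hH : IsConeOfSubharmonic H) :
    Convex ℝ (planarContinuousPart H) := fun _ hf _ hg _ _ ha hb hab ↦
  ⟨(hf.1.const_smul _).add (hg.1.const_smul _), hH.convex_continuousPart hf.2 hg.2 ha hb hab⟩

theorem continuousOn_of_mem_planarContinuousPart {f : ℂ → ℝ} (hf : f ∈ planarContinuousPart H) :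
    ContinuousOn f G :=
  continuousOn_iff_continuous_domRestrict.2 hf.2.1

theorem IsConeOfSubharmonic.hasAreaSubmean (hH : IsConeOfSubharmonic H) {f : ℂ → ℝ}
    (hf : f ∈ planarContinuousPart H) : HasAreaSubmean G fun z ↦ (f z : EReal) :=
  IsSubharmonic.hasAreaSubmean hf.1.coe_real_ereal (hH.isSubharmonic _ hf.2.2)

theorem IsSubharmonic.exists_forall_le {U : ℂ → EReal} (hU : IsSubharmonic fun z : G ↦ U z)
    {K : Set ℂ} (hKG : K ⊆ G) (hK : IsCompact K) : ∃ b : ℝ, ∀ z ∈ K, U z ≤ b := by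
  obtain ⟨b, hb⟩ := exists_forall_le_of_upperSemicontinuous hU.upperSemicontinuous hU.ne_top
    (isCompact_preimage_subtypeVal hK hKG)
  exact ⟨b, fun z hz ↦ hb ⟨z, hKG hz⟩ hz⟩

/-- A subharmonic function on a domain is locally integrable. -/
theorem IsSubharmonic.lintegral_neg_ne_top (hGo : IsOpen G) (hGc : IsConnected G) {U : ℂ → EReal}
    (hUm : Measurable U) (hU : IsSubharmonic fun z : G ↦ U z) {K : Set ℂ} (hKG : K ⊆ G)
    (hK : IsCompact K) : ∫⁻ z in K, (-U z).toENNReal ≠ ⊤ := by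
  obtain ⟨o, ho⟩ := hU.exists_ne_bot
  obtain ⟨C, hC, h⟩ := exists_lintegral_neg_le (ι := Unit) hGo hGc (U := fun _ ↦ U) (fun _ ↦ hUm)
    (fun _ ↦ hU.hasAreaSubmean hUm)
    (fun S hS hSc ↦ (hU.exists_forall_le hS hSc).imp fun b hb _ ↦ hb) o.2
    (c := (U o).toReal) (fun _ ↦ (EReal.coe_toReal (hU.ne_top o) ho).le) hKG hK
  exact ne_top_of_le_ne_top hC (h ())

/-- If `u + v ≤ M` holds almost everywhere for subharmonic `u`, `v` and continuous `M`, then it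
holds everywhere. -/
theorem add_le_of_ae_add_le (hGo : IsOpen G) {U V : ℂ → EReal} (hUm : Measurable U)
    (hVm : Measurable V) (hU : IsSubharmonic fun z : G ↦ U z) (hV : IsSubharmonic fun z : G ↦ V z)
    {M : ℂ → ℝ} (hM : ContinuousOn M G) (hae : ∀ᵐ z, z ∈ G → U z + V z ≤ M z) {z : ℂ}
    (hz : z ∈ G) : U z + V z ≤ M z := by
  have hUt := hU.ne_top ⟨z, hz⟩
  have hVt := hV.ne_top ⟨z, hz⟩
  simp only at hUt hVt
  by_cases hUb : U z = ⊥
  · simp [hUb]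
  by_cases hVb : V z = ⊥
  · simp [hVb]
  obtain ⟨x, hx⟩ : ∃ x : ℝ, U z = x := ⟨_, (EReal.coe_toReal hUt hUb).symm⟩
  obtain ⟨y, hy⟩ : ∃ y : ℝ, V z = y := ⟨_, (EReal.coe_toReal hVt hVb).symm⟩
  rw [hx, hy]
  norm_cast
  refine le_of_forall_pos_le_add fun ε hε ↦ ?_
  have hnear : ∀ᶠ w in 𝓝 z, w ∈ G ∧ M w < M z + ε := (hGo.eventually_mem hz).and
    ((hM.continuousAt (hGo.mem_nhds hz)).eventually (gt_mem_nhds (by linarith)))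
  obtain ⟨r, hr, hball⟩ := Metric.nhds_basis_closedBall.mem_iff.1 hnear
  have hBG : Metric.closedBall z r ⊆ G := fun w hw ↦ (hball hw).1
  have hBc := isCompact_closedBall z r
  obtain ⟨b, hb⟩ := hU.exists_forall_le hBG hBc
  obtain ⟨d, hd⟩ := hV.exists_forall_le hBG hBc
  have hzB := Metric.mem_closedBall_self (x := z) hr.le
  have hbx : x ≤ b := by have := hb z hzB; rw [hx] at this; exact_mod_cast this
  have hdy : y ≤ d := by have := hd z hzB; rw [hy] at this; exact_mod_cast this
  have : IsFiniteMeasure (volume.restrict (Metric.closedBall z r)) :=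
    ⟨by rw [Measure.restrict_apply_univ]; exact hBc.measure_lt_top⟩
  have h1 := ofReal_add_le_lintegral (μ := volume.restrict (Metric.closedBall z r))
    (f := U) (g := V) hUm (m := fun _ ↦ M z + ε) (integrable_const _)
    (ae_restrict_of_forall_mem measurableSet_closedBall hb)
    (ae_restrict_of_forall_mem measurableSet_closedBall hd)
    (by
      rw [ae_restrict_iff' measurableSet_closedBall]
      filter_upwards [hae] with w hw hwB
      exact (hw (hBG hwB)).trans (by exact_mod_cast (hball hwB).2.le))
  have h2 := h1.trans (add_le_add (hU.hasAreaSubmean hUm z r b hr hBG hb)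
    (hV.hasAreaSubmean hVm z r d hr hBG hd))
  rw [hx, hy, ← EReal.coe_sub, ← EReal.coe_sub, EReal.real_coe_toENNReal,
    EReal.real_coe_toENNReal, ← add_mul, ← ENNReal.ofReal_add (by linarith) (by linarith),
    ← ofReal_measureReal hBc.measure_ne_top, ← ENNReal.ofReal_mul (by linarith),
    ENNReal.ofReal_le_ofReal_iff (mul_nonneg (by linarith) measureReal_nonneg),
    setIntegral_const, measureReal_restrict_apply_univ, smul_eq_mul,
    volume_real_closedBall z hr.le] at h2
  have h3 : 0 < Real.pi * r ^ 2 := by positivity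
  have h4 : (b + d - (M z + ε)) * (Real.pi * r ^ 2) ≤ (b - x + (d - y)) * (Real.pi * r ^ 2) := by
    linarith
  linarith [le_of_mul_le_mul_right h4 h3]

/-- Functions with the sub-mean value property whose sums with a fixed subharmonic function are
locally bounded above are themselves locally bounded above. -/
theorem exists_forall_le_of_add_le (hGo : IsOpen G) (hGc : IsConnected G) {U : ℂ → EReal}
    (hUm : Measurable U) (hU : IsSubharmonic fun z : G ↦ U z) {M : ℂ → ℝ} (hM : ContinuousOn M G)
    {K : ℕ → Set ℂ} (hKmono : Monotone K) (hKex : ∀ S ⊆ G, IsCompact S → ∃ n, S ⊆ K n)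
    {h : ℕ → ℂ → ℝ} (hcont : ∀ n, ContinuousOn (h n) G)
    (hsub : ∀ n, HasAreaSubmean G fun z ↦ (h n z : EReal))
    (hle : ∀ n, ∀ z ∈ K n, U z + h n z ≤ M z) {S : Set ℂ} (hSG : S ⊆ G) (hS : IsCompact S) :
    ∃ b : ℝ, ∀ n, ∀ z ∈ S, h n z ≤ b := by
  obtain ⟨δ, hδ, hδG⟩ := hS.exists_cthickening_subset_open hGo hSG
  set T := Metric.cthickening δ S with hT
  have hTc : IsCompact T := hS.cthickening
  obtain ⟨N, hN⟩ := hKex T hδG hTc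
  obtain ⟨m, hm⟩ := (hTc.image_of_continuousOn (hM.mono hδG)).bddAbove
  have hTv := hTc.measure_ne_top (μ := volume)
  set E := ∫⁻ z in T, (ENNReal.ofReal m + (-U z).toENNReal) with hE
  have hEfin : E ≠ ⊤ := by
    rw [hE, lintegral_add_left measurable_const, setLIntegral_const]
    have := hU.lintegral_neg_ne_top hGo hGc hUm hδG hTc
    finiteness
  have hlarge : ∀ n ≥ N, ∀ z ∈ S, h n z ≤ (Real.pi * δ ^ 2)⁻¹ * E.toReal := by
    intro n hn z hz
    have hB : Metric.closedBall z δ ⊆ T := Metric.closedBall_subset_cthickening hz δ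
    refine ((hsub n).le_discMean (hcont n) hδ (hB.trans hδG)).trans ?_
    rw [discMean_eq]
    gcongr
    rw [← ENNReal.ofReal_le_iff_le_toReal hEfin]
    have hi : IntegrableOn (h n) (Metric.closedBall z δ) :=
      ((hcont n).mono (hB.trans hδG)).integrableOn_compact (isCompact_closedBall z δ)
    refine (ofReal_integral_le_lintegral hi).trans ((lintegral_mono_set hB).trans ?_)
    refine setLIntegral_mono' hTc.measurableSet fun w hw ↦ ?_
    have h1 := hle n w (hKmono hn (hN hw))
    have h2 : M w ≤ m := hm (Set.mem_image_of_mem M hw)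
    generalize U w = y at *
    induction y with
    | bot => simp
    | top => simp at h1
    | coe y =>
      rw [← EReal.coe_neg, EReal.real_coe_toENNReal]
      norm_cast at h1
      exact (ENNReal.ofReal_le_ofReal (by linarith)).trans ENNReal.ofReal_add_le
  choose b hb using fun n ↦ (hS.image_of_continuousOn ((hcont n).mono hSG)).bddAbove
  obtain ⟨b', hb'⟩ := ((Set.finite_lt_nat N).image b).bddAbove
  refine ⟨max b' ((Real.pi * δ ^ 2)⁻¹ * E.toReal), fun n z hz ↦ ?_⟩
  rcases lt_or_ge n N with hn | hn
  · exact (hb n (Set.mem_image_of_mem _ hz)).trans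
      ((hb' (Set.mem_image_of_mem b hn)).trans (le_max_left _ _))
  · exact (hlarge n hn z hz).trans (le_max_right _ _)

theorem exists_integral_abs_le (hGo : IsOpen G) (hGc : IsConnected G) {h : ℕ → ℂ → ℝ}
    (hm : ∀ n, Measurable (h n)) (hcont : ∀ n, ContinuousOn (h n) G)
    (hsub : ∀ n, HasAreaSubmean G fun z ↦ (h n z : EReal))
    (hbdd : ∀ S ⊆ G, IsCompact S → ∃ b : ℝ, ∀ n, ∀ z ∈ S, h n z ≤ b) {o : ℂ} (ho : o ∈ G) {c : ℝ}
    (hc : ∀ n, c ≤ h n o) {S : Set ℂ} (hSG : S ⊆ G) (hS : IsCompact S) :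
    ∃ C : ℝ, ∀ n, ∫ z in S, |h n z| ≤ C := by
  obtain ⟨C, hC, hle⟩ := exists_lintegral_neg_le hGo hGc (U := fun n z ↦ (h n z : EReal))
    (fun n ↦ (hm n).coe_real_ereal) hsub
    (fun T hT hTc ↦ (hbdd T hT hTc).imp fun b hb n z hz ↦ by exact_mod_cast hb n z hz) ho
    (fun n ↦ by exact_mod_cast hc n) hSG hS
  obtain ⟨b, hb⟩ := hbdd S hSG hS
  have hSv := hS.measure_ne_top (μ := volume)
  refine ⟨(ENNReal.ofReal b * volume S + C).toReal, fun n ↦ ?_⟩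
  have hi : IntegrableOn (h n) S := ((hcont n).mono hSG).integrableOn_compact hS
  rw [← ENNReal.ofReal_le_iff_le_toReal (by finiteness),
    ofReal_integral_eq_lintegral_ofReal hi.abs (.of_forall fun _ ↦ abs_nonneg _)]
  refine le_trans ?_ (add_le_add_right (hle n) _)
  rw [← setLIntegral_const, ← lintegral_add_left measurable_const]
  refine setLIntegral_mono' hS.measurableSet fun z hz ↦ ?_
  rw [← EReal.coe_neg, EReal.real_coe_toENNReal]
  rcases le_total 0 (h n z) with h0 | h0
  · rw [abs_of_nonneg h0]
    exact (ENNReal.ofReal_le_ofReal (hb n z hz)).trans le_self_add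
  · rw [abs_of_nonpos h0]
    exact le_add_self

theorem le_discMean_of_tendsto {f : ℕ → ℂ → ℝ} {w : ℂ → ℝ} (hf : ∀ n, ContinuousOn (f n) G)
    (hsub : ∀ n, HasAreaSubmean G fun z ↦ (f n z : EReal)) {o : ℂ} {c : ℝ} (hc : ∀ n, c ≤ f n o)
    {r : ℝ} (hr : 0 < r) (hball : Metric.closedBall o r ⊆ G)
    (hwi : IntegrableOn w (Metric.closedBall o r))
    (hw : Tendsto (fun n ↦ ∫⁻ z in Metric.closedBall o r, ENNReal.ofReal |f n z - w z|) atTop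
      (𝓝 0)) : c ≤ discMean r w o := by
  have h1 := tendsto_integral_of_L1 (μ := volume.restrict (Metric.closedBall o r)) w
    hwi.aestronglyMeasurable (F := f) (l := atTop)
    (.of_forall fun n ↦ ((hf n).mono hball).integrableOn_compact (isCompact_closedBall o r))
    (by simpa only [← Real.norm_eq_abs, ofReal_norm] using hw)
  rw [discMean_eq]
  refine ge_of_tendsto (h1.const_mul (Real.pi * r ^ 2)⁻¹) (.of_forall fun n ↦ ?_)
  rw [← discMean_eq]
  exact (hc n).trans ((hsub n).le_discMean (hf n) hr hball)

theorem ae_add_le_of_tendsto {U : ℂ → EReal} (hUm : Measurable U) {M w : ℂ → ℝ} {f : ℕ → ℂ → ℝ}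
    {K : Set ℂ} (hK : MeasurableSet K) (hw : AEMeasurable w (volume.restrict K))
    (hM : AEMeasurable M (volume.restrict K)) (hle : ∀ᶠ n in atTop, ∀ z ∈ K, U z + f n z ≤ M z)
    (hlim : Tendsto (fun n ↦ ∫⁻ z in K, ENNReal.ofReal |f n z - w z|) atTop (𝓝 0)) :
    ∀ᵐ z, z ∈ K → U z + w z ≤ M z := by
  have h0 : ∫⁻ z in K, (U z + w z - M z).toENNReal = 0 := by
    refine le_antisymm (ge_of_tendsto hlim ?_) bot_le
    filter_upwards [hle] with n hn
    refine setLIntegral_mono' hK fun z hz ↦ ?_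
    have h1 := hn z hz
    generalize U z = y at *
    induction y with
    | bot => simp
    | top => simp at h1
    | coe y =>
      norm_cast at h1
      rw [← EReal.coe_add, ← EReal.coe_sub, EReal.real_coe_toENNReal]
      exact ENNReal.ofReal_le_ofReal (by linarith [neg_abs_le (f n z - w z)])
  have hmeas : AEMeasurable (fun z ↦ (U z + w z - M z).toENNReal) (volume.restrict K) :=
    AEMeasurable.ereal_toENNReal
      ((hUm.aemeasurable.add hw.coe_real_ereal).sub hM.coe_real_ereal)
  rw [lintegral_eq_zero_iff' hmeas, EventuallyEq, ae_restrict_iff' hK] at h0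
  filter_upwards [h0] with z hz hzK
  have h1 := EReal.toENNReal_eq_zero_iff.1 (hz hzK)
  generalize U z = y at *
  induction y with
  | bot => simp
  | top => simp at h1
  | coe y => norm_cast at h1 ⊢; linarith

theorem exists_mem_add_le (hGo : IsOpen G) (hGc : IsConnected G) {o : G} {M : G → ℝ}
    (hM : Continuous M) {u : G → EReal} (hu : IsSubharmonic u) (hH : IsConeOfSubharmonic H)
    (hzero : (fun _ ↦ (0 : EReal)) ∈ H) (hneg : (fun _ ↦ (-1 : EReal)) ∈ H)
    (hclosed : IsSeqClosedL1Loc H) (happrox : HasContinuousApprox H) {C : ℝ}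
    (hC : ∀ μ : Measure G, IsJensenMeasure o H μ →
      eintegral μ u ≤ (((∫ z, M z ∂μ) + C : ℝ) : EReal)) :
    ∃ v ∈ H, v o ≠ ⊥ ∧ ∀ z, u z + v z ≤ M z := by
  have hGm := hGo.measurableSet
  obtain ⟨K, hKmono, hKc, hKG, hKex⟩ := exists_compact_exhaustion hGo
  obtain ⟨U, hUm, hUu⟩ := exists_measurable_extension hGm hu.upperSemicontinuous.measurable
  obtain ⟨M', hM'm, hMM'⟩ := exists_measurable_extension hGm hM.measurable
  have hU : IsSubharmonic fun z : G ↦ U z := by simpa only [hUu] using hu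
  have hM' : ContinuousOn M' G := continuousOn_iff_continuous_domRestrict.2 (by
    convert hM using 1; ext z; exact hMM' z)
  have hex : ∀ n, ∃ h ∈ planarContinuousPart H, -(C + 1) < h o ∧
      ∀ z ∈ K n, U z + h z ≤ M' z := fun n ↦ by
    obtain ⟨h, hh, ho, hle⟩ := exists_mem_continuousPart_add_le hH hzero hneg happrox
      hu.upperSemicontinuous hu.ne_top hM hC (isCompact_preimage_subtypeVal (hKc n) (hKG n))
    obtain ⟨h', hm, hhh'⟩ := exists_measurable_extension hGm hh.1.measurable
    refine ⟨h', ⟨hm, by simpa only [hhh'] using hh⟩, by rwa [hhh'], fun z hz ↦ ?_⟩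
    have hzG := hKG n hz
    have := hle ⟨z, hzG⟩ hz
    rwa [← hUu, ← hhh', ← hMM'] at this
  choose h hhC ho hle using hex
  have hcont := fun n ↦ continuousOn_of_mem_planarContinuousPart (hhC n)
  have hsub := fun n ↦ hH.hasAreaSubmean (hhC n)
  obtain ⟨f, hfD, hcau⟩ := exists_convexHull_seq_cauchy hGo hH.convex_planarContinuousPart
    (fun f hf ↦ continuousOn_of_mem_planarContinuousPart hf) (fun f hf ↦ hH.hasAreaSubmean hf) hhC
    (fun S hS hSc ↦ exists_integral_abs_le hGo hGc (fun n ↦ (hhC n).1) hcont hsub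
      (fun T hT hTc ↦ exists_forall_le_of_add_le hGo hGc hUm hU hM' hKmono hKex hcont hsub hle
        hT hTc) o.2 (fun n ↦ (ho n).le) hS hSc)
  have hfC : ∀ n, f n ∈ planarContinuousPart H := fun n ↦
    convexHull_min (by rintro _ ⟨m, _, rfl⟩; exact hhC m) hH.convex_planarContinuousPart (hfD n)
  have hfo : ∀ n, -(C + 1) ≤ f n o := fun n ↦ by
    have hconv : Convex ℝ {g : ℂ → ℝ | -(C + 1) ≤ g o} :=
      (convex_Ici _).is_linear_preimage (LinearMap.proj (R := ℝ) (o : ℂ)).isLinear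
    exact convexHull_min (by rintro _ ⟨m, _, rfl⟩; exact (ho m).le) hconv (hfD n)
  have hfle : ∀ n, ∀ z ∈ K n, U z + f n z ≤ M' z := fun n z hz ↦ by
    have hconv : Convex ℝ {g : ℂ → ℝ | U z + g z ≤ M' z} :=
      (convex_setOf_add_le (U z) (M' z)).is_linear_preimage (LinearMap.proj (R := ℝ) z).isLinear
    exact convexHull_min (by rintro _ ⟨m, hm, rfl⟩; exact hle m z (hKmono hm hz)) hconv (hfD n)
  have hfcont := fun n ↦ continuousOn_of_mem_planarContinuousPart (hfC n)
  obtain ⟨w, hw⟩ := exists_tendsto_of_cauchy_on_compacts hGo hfcont hcau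
  have hloc : LocallyCompactSpace G := hGo.locallyCompactSpace
  have himg : ∀ S : Set G, IsCompact S → IsCompact (Subtype.val '' S : Set ℂ) := fun S hS ↦
    hS.image continuous_subtype_val
  obtain ⟨v, hvH, hvw⟩ := hclosed (fun n z ↦ (f n z : EReal)) (fun z ↦ w z)
    (fun n ↦ (hfC n).2.2)
    (locallyIntegrable_iff.2 fun S hS ↦ (integrableOn_comp_subtypeVal_iff hGm).2
      (hw _ (Subtype.coe_image_subset _ _) (himg S hS)).1)
    (fun S hS ↦ by
      refine (hw _ (Subtype.coe_image_subset _ _) (himg S hS)).2.congr fun n ↦ ?_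
      rw [areaMeasure, ← setLIntegral_subtype hGm]
      simp)
  have hv := hH.isSubharmonic v hvH
  obtain ⟨V, hVm, hVv⟩ := exists_measurable_extension hGm hv.upperSemicontinuous.measurable
  have hV : IsSubharmonic fun z : G ↦ V z := by simpa only [hVv] using hv
  have hVw : ∀ᵐ z, z ∈ G → V z = w z := by
    rw [← ae_areaMeasure_iff hGm]
    filter_upwards [hvw] with z hz
    rw [hVv, hz]
  refine ⟨v, hvH, fun hbot ↦ ?_, fun z ↦ ?_⟩
  · have hlt : v o < ((-(C + 2) : ℝ) : EReal) := by rw [hbot]; exact EReal.bot_lt_coe _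
    have hnear := hv.upperSemicontinuous o _ hlt
    rw [nhds_subtype_eq_comap, eventually_comap] at hnear
    obtain ⟨r, hr, hball⟩ := Metric.nhds_basis_closedBall.mem_iff.1
      (hnear.and (hGo.eventually_mem o.2))
    have hBG : Metric.closedBall (o : ℂ) r ⊆ G := fun z hz ↦ (hball hz).2
    obtain ⟨hwi, hwlim⟩ := hw _ hBG (isCompact_closedBall (o : ℂ) r)
    have h1 := le_discMean_of_tendsto hfcont (fun n ↦ hH.hasAreaSubmean (hfC n)) hfo hr hBG hwi
      hwlim
    have h2 : discMean r w o ≤ discMean r (fun _ ↦ -(C + 2)) o := by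
      rw [discMean_eq, discMean_eq]
      gcongr ?_ * ?_
      refine setIntegral_mono_ae_restrict hwi
        (integrableOn_const (isCompact_closedBall (o : ℂ) r).measure_ne_top) ?_
      rw [EventuallyLE, ae_restrict_iff' measurableSet_closedBall]
      filter_upwards [hVw] with z hz hzB
      have h3 : v ⟨z, hBG hzB⟩ < ((-(C + 2) : ℝ) : EReal) := (hball hzB).1 ⟨z, hBG hzB⟩ rfl
      rw [← hVv, hz (hBG hzB)] at h3
      exact_mod_cast h3.le
    rw [discMean_const hr] at h2
    linarith
  · rw [← hUu, ← hVv, ← hMM']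
    refine add_le_of_ae_add_le hGo hUm hVm hU hV hM' ?_ z.2
    have hK : ∀ k, ∀ᵐ z, z ∈ K k → U z + w z ≤ M' z := fun k ↦ by
      obtain ⟨hwi, hwlim⟩ := hw _ (hKG k) (hKc k)
      refine ae_add_le_of_tendsto hUm (hKc k).measurableSet
        hwi.aestronglyMeasurable.aemeasurable hM'm.aemeasurable ?_ hwlim
      filter_upwards [eventually_ge_atTop k] with n hn z hz using hfle n z (hKmono hn hz)
    filter_upwards [hVw, ae_all_iff.2 hK] with z hzV hzK hzG
    obtain ⟨k, hk⟩ := hKex {z} (by simpa using hzG) isCompact_singleton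
    rw [hzV hzG]
    exact hzK k (hk rfl)

end Duality

end JensenDuality

end

theorem mainTheorem1 (G : Set ℂ) (hGo : IsOpen G) (hGc : IsConnected G) (h0 : (0 : ℂ) ∈ G)
    (M : G → ℝ) (hM : Continuous M)
    (u : G → EReal) (hu : JensenDuality.IsSubharmonic u)
    (H : Set (G → EReal)) (hH : JensenDuality.IsConeOfSubharmonic H)
    (hzero : (fun _ ↦ (0 : EReal)) ∈ H) (hneg : (fun _ ↦ (-1 : EReal)) ∈ H)
    (hclosed : JensenDuality.IsSeqClosedL1Loc H)
    (happrox : JensenDuality.HasContinuousApprox H) :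
    (∃ v ∈ H, v ⟨0, h0⟩ ≠ ⊥ ∧ ∀ z, u z + v z ≤ (M z : EReal)) ↔
      ∃ C : ℝ, ∀ μ : MeasureTheory.Measure G, JensenDuality.IsJensenMeasure ⟨0, h0⟩ H μ →
        JensenDuality.eintegral μ u ≤ (((∫ z, M z ∂μ) + C : ℝ) : EReal) := by
  constructor
  · rintro ⟨v, hv, hv0, hle⟩
    exact ⟨_, fun μ hμ ↦
      JensenDuality.eintegral_le_of_forall_add_le hu hH.isSubharmonic hv hv0 hM hle hμ⟩
  · rintro ⟨C, hC⟩
    exact JensenDuality.exists_mem_add_le hGo hGc hM hu hH hzero hneg hclosed happrox hC
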